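/- Let $E$ be a (real) vector lattice that is Dedekind $\sigma$-complete (every nonempty countable set that is bounded above has a supremum) and laterally $\sigma$-complete (every nonempty countable set of pairwise disjoint positive vectors has a supremum), and let $F$ be a normed lattice that is atomic (the band generated by its atoms is $F$) and has order continuous norm ($x_\alpha\downarrow 0$ implies $\|x_\alpha\|\to 0$). A net $(x_\alpha)$ is order convergent to $x$, written $x_\alpha\xrightarrow{o}x$, if there is a net $z_\beta\downarrow 0$ such that for every $\beta$ one has $|x_\alpha-x|\le z_\beta$ for all sufficiently large $\alpha$; it is $uo$-convergent to $x$, written $x_\alpha\xrightarrow{uo}x$, if $|x_\alpha-x|\wedge u\xrightarrow{o}0$ for every $u\ge 0$. A linear operator $T:E\to F$ is order bounded if it maps order bounded sets to order bounded sets, $\sigma$-order continuous if $x_n\xrightarrow{o}0$ implies $Tx_n\xrightarrow{o}0$ for sequences, and $\sigma$-$uon$-continuous if $x_n\xrightarrow{uo}0$ in $E$ implies $\|Tx_n\|\to 0$. Let $L_b(E,F)$ be the space of order bounded operators, ordered by $S\le T$ iff $Sx\le Tx$ for all $x\ge 0$, and let $L^\sigma_{uon}(E,F)$ be the space of $\sigma$-$uon$-continuous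 operators. A band is an order closed ideal. For a vector lattice $G$ let $G_n^\sim$ be the space of order bounded, order continuous linear functionals on $G$, ordered in the same way; $G$ is perfect if the natural map $x\mapsto\hat x$, $\hat x(f)=f(x)$, is a bijection of $G$ onto $(G_n^\sim)_n^\sim$. Then: 1. An order bounded operator $T:E\to F$ is $\sigma$-order continuous if and only if it is $\sigma$-$uon$-continuous. Moreover, $L_b(E,F)$ is a vector lattice and $L^\sigma_{uon}(E,F)\cap L_b(E,F)$ is a band in $L_b(E,F)$. 2. If $F$ is a perfect vector lattice, then $L^\sigma_{uon}(E,F)\cap L_b(E,F)$ is a perfect vector lattice. -/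

import Mathlib

open Filter Topology

universe u v w

namespace RieszUON

section Order

variable {V : Type u} [AddCommGroup V] [Preorder V]

/-- `x i` is order convergent to `a`. The set `Z` is the range of a net `z ↓ 0`: it is nonempty,
downward directed and has infimum `0`. The inequality `-z ≤ x i - a ≤ z` is `|x i - a| ≤ z`
as soon as `V` is a vector lattice, see `ordTendsto_iff_abs`. -/
def OrdTendsto {ι : Type w} [Preorder ι] (x : ι → V) (a : V) : Prop :=
  ∃ Z : Set V, Z.Nonempty ∧ DirectedOn (fun s t => t ≤ s) Z ∧ IsGLB Z 0 ∧
    ∀ z ∈ Z, ∃ i₀, ∀ i, i₀ ≤ i → -z ≤ x i - a ∧ x i - a ≤ z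

/-- `m` is the modulus `x ∨ (-x)` of `x`. -/
def IsModulus (x m : V) : Prop := IsLUB {x, -x} m

variable [Module ℝ V]

variable (V) in
/-- The preordered real vector space `V` is a vector lattice (Riesz space). -/
structure IsVectorLattice : Prop where
  antisymm : ∀ x y : V, x ≤ y → y ≤ x → x = y
  add_le_add_left : ∀ x y z : V, x ≤ y → z + x ≤ z + y
  smul_nonneg : ∀ (c : ℝ) (x : V), 0 ≤ c → 0 ≤ x → 0 ≤ c • x
  exists_sup : ∀ x y : V, ∃ z, IsLUB {x, y} z
  exists_inf : ∀ x y : V, ∃ z, IsGLB {x, y} z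

/-- A linear subspace is a band if it is an order closed ideal, i.e. solid and closed under
order limits of nets. (Nets indexed in the universe of `V` are enough, because the
convergence of a net only depends on its tails, which are subsets of `V`.) -/
structure IsBand (B : Submodule ℝ V) : Prop where
  solid : ∀ x y mx my : V, IsModulus x mx → IsModulus y my → mx ≤ my → y ∈ B → x ∈ B
  order_closed : ∀ (ι : Type u) [Preorder ι] [IsDirectedOrder ι] [Nonempty ι] (x : ι → V) (a : V),
    (∀ i, x i ∈ B) → OrdTendsto x a → a ∈ B

end Order

section VectorLattice

variable {E : Type u} [AddCommGroup E] [Lattice E]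

theorem ordTendsto_iff_abs [IsOrderedAddMonoid E] {ι : Type w} [Preorder ι] (x : ι → E) (a : E) :
    OrdTendsto x a ↔ ∃ Z : Set E, Z.Nonempty ∧ DirectedOn (fun s t => t ≤ s) Z ∧ IsGLB Z 0 ∧
      ∀ z ∈ Z, ∃ i₀, ∀ i, i₀ ≤ i → |x i - a| ≤ z := by
  simp only [OrdTendsto, abs_le']
  refine exists_congr fun Z => and_congr_right fun _ => and_congr_right fun _ =>
    and_congr_right fun _ => forall₂_congr fun z _ => exists_congr fun i₀ =>
    forall₂_congr fun i _ => ?_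
  rw [and_comm, neg_le (a := z)]

/-- `x i` is unbounded order convergent to `a`. -/
def UoTendsto {ι : Type w} [Preorder ι] (x : ι → E) (a : E) : Prop :=
  ∀ y : E, 0 ≤ y → OrdTendsto (fun i => |x i - a| ⊓ y) 0

variable (E) in
/-- Every nonempty countable subset that is bounded above has a supremum. -/
def DedekindSigmaComplete : Prop :=
  ∀ S : Set E, S.Nonempty → S.Countable → BddAbove S → ∃ s, IsLUB S s

variable (E) in
/-- Every nonempty countable set of pairwise disjoint positive vectors has a supremum. -/
def LaterallySigmaComplete : Prop :=
  ∀ S : Set E, S.Nonempty → S.Countable → (∀ x ∈ S, 0 ≤ x) →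
    S.Pairwise (fun x y => |x| ⊓ |y| = 0) → ∃ s, IsLUB S s

/-- `a` is an atom: a nonzero positive vector such that disjoint `x, y ∈ [0, a]` cannot both
be nonzero. -/
def IsLatticeAtom (a : E) : Prop :=
  0 ≤ a ∧ a ≠ 0 ∧ ∀ x ∈ Set.Icc 0 a, ∀ y ∈ Set.Icc 0 a, |x| ⊓ |y| = 0 → x = 0 ∨ y = 0

variable (E) in
/-- `E` is atomic: the band generated by the atoms is all of `E`. -/
def IsAtomicLattice [Module ℝ E] : Prop :=
  ∀ B : Submodule ℝ E, IsBand B → (∀ a, IsLatticeAtom a → a ∈ B) → B = ⊤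

end VectorLattice

/-- The norm is order continuous: `x i ↓ 0` implies `‖x i‖ → 0`. -/
def HasOrderContinuousNorm (F : Type v) [NormedAddCommGroup F] [Lattice F] : Prop :=
  ∀ (ι : Type v) [Preorder ι] [IsDirectedOrder ι] [Nonempty ι] (x : ι → F),
    Antitone x → IsGLB (Set.range x) 0 → Tendsto (fun i => ‖x i‖) atTop (𝓝 0)

section Operators

variable {V : Type u} [AddCommGroup V] [Preorder V] [Module ℝ V]
variable {W : Type v} [AddCommGroup W] [PartialOrder W] [Module ℝ W]

/-- `T` maps order bounded sets to order bounded sets. -/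
def IsOrderBounded (T : V →ₗ[ℝ] W) : Prop :=
  ∀ a b : V, ∃ c d : W, T '' Set.Icc a b ⊆ Set.Icc c d

/-- `T` is `σ`-order continuous. -/
def IsSigmaOrderContinuous (T : V →ₗ[ℝ] W) : Prop :=
  ∀ x : ℕ → V, OrdTendsto x 0 → OrdTendsto (fun n => T (x n)) 0

variable (V W) in
/-- The space `L_b(V, W)` of order bounded linear operators. -/
def Lb [IsOrderedAddMonoid W] [IsOrderedModule ℝ W] : Submodule ℝ (V →ₗ[ℝ] W) where
  carrier := {T | IsOrderBounded T}
  zero_mem' := fun a b => ⟨0, 0, by rintro _ ⟨x, -, rfl⟩; simp⟩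
  add_mem' := by
    intro S T hS hT a b
    obtain ⟨c, d, h⟩ := hS a b
    obtain ⟨c', d', h'⟩ := hT a b
    refine ⟨c + c', d + d', ?_⟩
    rintro _ ⟨x, hx, rfl⟩
    have h₁ := h ⟨x, hx, rfl⟩
    have h₂ := h' ⟨x, hx, rfl⟩
    exact ⟨add_le_add h₁.1 h₂.1, add_le_add h₁.2 h₂.2⟩
  smul_mem' := by
    intro r T hT a b
    obtain ⟨c, d, h⟩ := hT a b
    rcases le_total 0 r with hr | hr
    · refine ⟨r • c, r • d, ?_⟩
      rintro _ ⟨x, hx, rfl⟩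
      have h₁ := h ⟨x, hx, rfl⟩
      exact ⟨smul_le_smul_of_nonneg_left h₁.1 hr, smul_le_smul_of_nonneg_left h₁.2 hr⟩
    · refine ⟨r • d, r • c, ?_⟩
      rintro _ ⟨x, hx, rfl⟩
      have h₁ := h ⟨x, hx, rfl⟩
      exact ⟨smul_le_smul_of_nonpos_left h₁.2 hr, smul_le_smul_of_nonpos_left h₁.1 hr⟩

/-- The operator order on `L_b(V, W)`: `S ≤ T` iff `S x ≤ T x` for all `x ≥ 0`. -/
instance Lb.instPreorder [IsOrderedAddMonoid W] [IsOrderedModule ℝ W] : Preorder (Lb V W) where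
  le S T := ∀ x : V, 0 ≤ x → S.1 x ≤ T.1 x
  le_refl _ _ _ := le_rfl
  le_trans _ _ _ h₁ h₂ x hx := (h₁ x hx).trans (h₂ x hx)

/-- The linear functional `f` is order continuous: `x i → 0` in order implies `f (x i) → 0`
(in `ℝ`, order convergence of nets is the usual convergence). -/
def IsOrderContinuousFunctional (f : V →ₗ[ℝ] ℝ) : Prop :=
  ∀ (ι : Type u) [Preorder ι] [IsDirectedOrder ι] [Nonempty ι] (x : ι → V),
    OrdTendsto x 0 → Tendsto (fun i => f (x i)) atTop (𝓝 0)

variable (V) in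
/-- The order continuous dual `V_n^∼`: the order bounded, order continuous linear functionals. -/
def OrdContDual : Submodule ℝ (V →ₗ[ℝ] ℝ) where
  carrier := {f | f ∈ Lb V ℝ ∧ IsOrderContinuousFunctional f}
  zero_mem' := ⟨zero_mem _, fun ι _ _ _ x _ => by simp⟩
  add_mem' := fun hf hg => ⟨add_mem hf.1 hg.1, fun ι _ _ _ x hx => by
    simpa using (hf.2 ι x hx).add (hg.2 ι x hx)⟩
  smul_mem' := fun c f hf => ⟨Submodule.smul_mem _ c hf.1, fun ι _ _ _ x hx => by
    simpa using (hf.2 ι x hx).const_mul c⟩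

/-- The order on `V_n^∼`: `f ≤ g` iff `f x ≤ g x` for all `x ≥ 0`. -/
instance OrdContDual.instPreorder : Preorder (OrdContDual V) where
  le f g := ∀ x : V, 0 ≤ x → f.1 x ≤ g.1 x
  le_refl _ _ _ := le_rfl
  le_trans _ _ _ h₁ h₂ x hx := (h₁ x hx).trans (h₂ x hx)

variable (V) in
/-- The natural map `x ↦ x̂`, `x̂ f = f x`, from `V` to the linear functionals on `V_n^∼`. -/
def evalOrdContDual : V →ₗ[ℝ] (OrdContDual V →ₗ[ℝ] ℝ) where
  toFun x :=
    { toFun := fun f => f.1 x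
      map_add' := fun _ _ => rfl
      map_smul' := fun _ _ => rfl }
  map_add' x y := by ext f; exact map_add f.1 x y
  map_smul' c x := by ext f; exact map_smul f.1 c x

variable (V) in
/-- `V` is a perfect vector lattice: `x ↦ x̂` is one-to-one from `V` onto `(V_n^∼)_n^∼`. -/
structure IsPerfect : Prop where
  isVectorLattice : IsVectorLattice V
  bijOn : Set.BijOn (evalOrdContDual V) Set.univ
    (OrdContDual (OrdContDual V) : Set (OrdContDual V →ₗ[ℝ] ℝ))

end Operators

section UON

variable {E : Type u} [AddCommGroup E] [Lattice E] [Module ℝ E]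
variable {F : Type v} [NormedAddCommGroup F] [NormedSpace ℝ F]

/-- `T` is `σ`-`uon`-continuous (unbounded `σ`-order-to-norm continuous). -/
def IsSigmaUonContinuous (T : E →ₗ[ℝ] F) : Prop :=
  ∀ x : ℕ → E, UoTendsto x 0 → Tendsto (fun n => ‖T (x n)‖) atTop (𝓝 0)

variable (E F) in
/-- The space `L^σ_uon(E, F)` of `σ`-`uon`-continuous linear operators. -/
def Luon : Submodule ℝ (E →ₗ[ℝ] F) where
  carrier := {T | IsSigmaUonContinuous T}
  zero_mem' := fun x _ => by simp
  add_mem' := fun hS hT x hx => by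
    have h₁ := tendsto_zero_iff_norm_tendsto_zero.2 (hS x hx)
    have h₂ := tendsto_zero_iff_norm_tendsto_zero.2 (hT x hx)
    exact tendsto_zero_iff_norm_tendsto_zero.1 (by simpa using h₁.add h₂)
  smul_mem' := fun c T hT x hx => by
    have h₁ := tendsto_zero_iff_norm_tendsto_zero.2 (hT x hx)
    exact tendsto_zero_iff_norm_tendsto_zero.1 (by simpa using h₁.const_smul c)

variable (E F) in
/-- `L^σ_uon(E, F) ∩ L_b(E, F)` as a linear subspace of the ordered space `L_b(E, F)`. -/
abbrev LuonLb [Lattice F] [IsOrderedAddMonoid F] [IsOrderedModule ℝ F] :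
    Submodule ℝ (Lb E F) :=
  (Luon E F).submoduleOf (Lb E F)

end UON

end RieszUON

set_option linter.unusedSectionVars false
set_option linter.unusedVariables false

namespace RieszUON

/-! ### Disjointness and band components in lattice-ordered groups. -/

section LatticeGroup

variable {E : Type u} [AddCommGroup E] [Lattice E] [IsOrderedAddMonoid E]

/-! The completeness of `E` forces every order bounded `T : E → F` to have finite rank, with real
lattice homomorphisms as coordinates. Such a `T` is controlled by the solid seminorm `p x = sup {‖T
y‖ : 0 ≤ y ≤ |x|}` (`IsOrderBounded.exists_seminorm`). Solid seminorms on `E` are automatically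
`σ`-order continuous (`IsSolidSeminorm.exists_lt`). Moreover a sequence that is disjoint modulo the
kernel of `p` must meet that kernel: otherwise it could be corrected to a truly disjoint sequence
and rescaled so that its supremum has `p`-value above every `n`
(`IsSolidSeminorm.exists_eq_zero_of_pairwise`). So modulo the kernel `E` is spanned by finitely many
atoms, and the coefficient along an atom is a lattice homomorphism (`IsAtomModKer.exists_latHom`,
`IsSolidSeminorm.exists_finite_repr`).

Real lattice homomorphisms on `E` are `σ`-`uo`-continuous (`IsLatHom.tendsto_of_uoTendsto`). Hence
all order bounded operators have both continuity properties, and the space in question is the whole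
of `L_b(E, F)`. Homomorphisms on different rays are independent, so `L_b(E, F)` is order isomorphic
to the finitely supported `F`-valued functions on the set of rays (`exists_linearEquiv_finsupp`),
which is a vector lattice.

Perfectness passes from `F` to such a direct sum (`IsPerfect.of_linearEquiv_finsupp`): its order
continuous dual contains every glued family of functionals on the summands, so an order bounded
functional on that dual can see only finitely many summands. -/

theorem inf_add_le_inf_add_inf {x y z : E} (hx : 0 ≤ x) (hy : 0 ≤ y) (hz : 0 ≤ z) :
    x ⊓ (y + z) ≤ x ⊓ y + x ⊓ z := by
  rw [inf_add, add_inf, add_inf]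
  refine le_inf (le_inf ?_ ?_) (le_inf ?_ inf_le_right)
  · exact inf_le_left.trans (le_add_of_nonneg_left hx)
  · exact inf_le_left.trans (le_add_of_nonneg_right hz)
  · exact inf_le_left.trans (le_add_of_nonneg_left hy)

theorem inf_nsmul_le {x y : E} (hx : 0 ≤ x) (hy : 0 ≤ y) (k : ℕ) :
    x ⊓ k • y ≤ k • (x ⊓ y) := by
  induction k with
  | zero => simp
  | succ k ih =>
    rw [succ_nsmul, succ_nsmul]
    exact (inf_add_le_inf_add_inf hx (nsmul_nonneg hy k) hy).trans (add_le_add_left ih _)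

theorem inf_eq_zero_of_le {x y x' y' : E} (h : x ⊓ y = 0) (hx' : 0 ≤ x') (hy' : 0 ≤ y')
    (hx : x' ≤ x) (hy : y' ≤ y) : x' ⊓ y' = 0 :=
  le_antisymm ((inf_le_inf hx hy).trans h.le) (le_inf hx' hy')

theorem inf_nsmul_eq_zero {x y : E} (hx : 0 ≤ x) (hy : 0 ≤ y) (h : x ⊓ y = 0) (k : ℕ) :
    x ⊓ k • y = 0 :=
  le_antisymm ((inf_nsmul_le hx hy k).trans (by simp [h])) (le_inf hx (nsmul_nonneg hy k))

theorem add_le_of_inf_eq_zero {x y z : E} (h : x ⊓ y = 0) (hx : x ≤ z) (hy : y ≤ z) :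
    x + y ≤ z := by
  rw [← inf_add_sup, h, zero_add]
  exact sup_le hx hy

/-- The supremum of `x ⊓ k • s` is the component of `x` in the band generated by `s`. -/
def IsComponent (s x P : E) : Prop := IsLUB (Set.range fun k : ℕ => x ⊓ k • s) P

namespace IsComponent

variable {s x P : E}

theorem exists_isComponent (hE : DedekindSigmaComplete E) (s x : E) : ∃ P, IsComponent s x P :=
  hE _ (Set.range_nonempty _) (Set.countable_range _)
    ⟨x, by rintro _ ⟨k, rfl⟩; exact inf_le_left⟩

theorem inf_le (h : IsComponent s x P) (k : ℕ) : x ⊓ k • s ≤ P := h.1 ⟨k, rfl⟩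

theorem le (h : IsComponent s x P) : P ≤ x :=
  h.2 (by rintro _ ⟨k, rfl⟩; exact inf_le_left)

theorem nonneg (h : IsComponent s x P) (hx : 0 ≤ x) : 0 ≤ P := by
  simpa [hx] using h.inf_le 0

/-- With `w` the infimum in question, `x ⊓ k • s + w` is below both `x` and `(k + 1) • s`, hence
below `P`; so `P - w` is still an upper bound. -/
theorem sub_inf_eq_zero (h : IsComponent s x P) (hs : 0 ≤ s) : (x - P) ⊓ s = 0 := by
  refine le_antisymm ?_ (le_inf (sub_nonneg.2 h.le) hs)
  set w := (x - P) ⊓ s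
  suffices P ≤ P - w by simpa using this
  refine h.2 ?_
  rintro _ ⟨k, rfl⟩
  rw [le_sub_iff_add_le]
  refine le_trans (le_inf ?_ ?_) (h.inf_le (k + 1))
  · calc x ⊓ k • s + w ≤ P + (x - P) := add_le_add (h.inf_le k) inf_le_left
      _ = x := by abel
  · rw [succ_nsmul]
    exact add_le_add inf_le_right inf_le_right

/-- Disjointness from `s` passes to each `x ⊓ k • s`, so `c + x ⊓ k • s ≤ c ⊔ P`; the supremum over
`k` gives `c + P ≤ c ⊔ P`. -/
theorem inf_eq_zero (h : IsComponent s x P) (hs : 0 ≤ s) (hx : 0 ≤ x) {c : E} (hc : 0 ≤ c)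
    (hsc : c ⊓ s = 0) : c ⊓ P = 0 := by
  refine le_antisymm ?_ (le_inf hc (h.nonneg hx))
  suffices P ≤ c ⊔ P - c by
    have h1 : c ⊓ P = c + P - c ⊔ P := eq_sub_of_add_eq (inf_add_sup c P)
    rw [h1, sub_nonpos]
    rwa [le_sub_iff_add_le'] at this
  refine h.2 ?_
  rintro _ ⟨k, rfl⟩
  rw [le_sub_iff_add_le']
  exact add_le_of_inf_eq_zero
    (inf_eq_zero_of_le (inf_nsmul_eq_zero hc hs hsc k) hc (le_inf hx (nsmul_nonneg hs k))
      le_rfl inf_le_right) le_sup_left (le_sup_of_le_right (h.inf_le k))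

theorem mono {s' P' : E} (h : IsComponent s x P) (h' : IsComponent s' x P') (hs : s ≤ s') :
    P ≤ P' := by
  refine h.2 ?_
  rintro _ ⟨k, rfl⟩
  exact (inf_le_inf_left _ (nsmul_le_nsmul_right hs k)).trans (h'.inf_le k)

end IsComponent

end LatticeGroup

/-! ### Automatic `σ`-continuity of solid seminorms and real lattice homomorphisms. -/

section RieszSpace

variable {E : Type u} [AddCommGroup E] [Lattice E] [IsOrderedAddMonoid E]
  [Module ℝ E] [IsOrderedModule ℝ E]

theorem smul_sup_of_nonneg {c : ℝ} (hc : 0 ≤ c) (x y : E) : c • (x ⊔ y) = c • x ⊔ c • y := by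
  rcases hc.eq_or_lt with rfl | hc
  · simp
  · exact map_sup (OrderIso.smulRight hc : E ≃o E) x y

theorem abs_smul_eq (c : ℝ) (x : E) : |c • x| = |c| • |x| := by
  rcases le_total 0 c with hc | hc
  · rw [abs_of_nonneg hc, abs, abs, smul_sup_of_nonneg hc, smul_neg]
  · rw [abs_of_nonpos hc, abs, abs, smul_sup_of_nonneg (neg_nonneg.2 hc), smul_neg, neg_smul,
      neg_neg, sup_comm]

theorem smul_inf_eq_zero {c : ℝ} {x y : E} (hc : 0 ≤ c) (hx : 0 ≤ x) (hy : 0 ≤ y)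
    (h : x ⊓ y = 0) : (c • x) ⊓ y = 0 := by
  obtain ⟨n, hn⟩ := exists_nat_ge c
  rw [inf_comm] at h ⊢
  refine inf_eq_zero_of_le (inf_nsmul_eq_zero hy hx h n) hy (smul_nonneg hc hx) le_rfl ?_
  rw [← Nat.cast_smul_eq_nsmul ℝ]
  exact smul_le_smul_of_nonneg_right hn hx

/-- Monotone in the modulus. -/
def IsSolidSeminorm (p : Seminorm ℝ E) : Prop := ∀ x y : E, |x| ≤ |y| → p x ≤ p y

theorem IsSolidSeminorm.mono {p : Seminorm ℝ E} (hp : IsSolidSeminorm p) {x y : E} (hx : 0 ≤ x)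
    (hxy : x ≤ y) : p x ≤ p y :=
  hp x y (by rwa [abs_of_nonneg hx, abs_of_nonneg (hx.trans hxy)])

/-- In a universally `σ`-complete space, the bands on which a sequence decreasing to `0`
exceeds `ε • y 0` shrink so fast that a single vector dominates all multiples. -/
theorem exists_forall_nsmul_posPart_le (hE_ded : DedekindSigmaComplete E)
    (hE_lat : LaterallySigmaComplete E) {y : ℕ → E} (hy : Antitone y)
    (h0 : IsGLB (Set.range y) 0) {ε : ℝ} (hε : 0 < ε) :
    ∃ u : E, ∀ k : ℕ, k • (y k - ε • y 0)⁺ ≤ u := by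
  have hy0 : ∀ n, 0 ≤ y n := fun n => h0.1 ⟨n, rfl⟩
  set a := y 0
  have hεa : 0 ≤ ε • a := smul_nonneg hε.le (hy0 0)
  set v : ℕ → E := fun n => (y n - ε • a)⁺
  have hv0 : ∀ n, 0 ≤ v n := fun n => posPart_nonneg _
  have hvanti : Antitone v := fun m n h => posPart_mono (sub_le_sub_right (hy h) _)
  choose P hP using fun n => IsComponent.exists_isComponent hE_ded (v n) a
  have hP0 : ∀ n, 0 ≤ P n := fun n => (hP n).nonneg (hy0 0)
  have hPanti : Antitone P := fun m n h => (hP n).mono (hP m) (hvanti h)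
  have hdis : ∀ m n, m ≤ n → ∀ c, 0 ≤ c → c ≤ a - P m → c ⊓ P n = 0 := by
    intro m n hmn c hc hca
    refine (hP n).inf_eq_zero (hv0 n) (hy0 0) hc ?_
    exact inf_eq_zero_of_le ((hP m).sub_inf_eq_zero (hv0 m)) hc (hv0 n) hca (hvanti hmn)
  -- On the band of `v n` the vector `y n` exceeds `ε • a`: the excess `(ε • P n - y n)⁺` lies below
  -- two disjoint vectors, `ε • P n` and `(y n - ε • a)⁻`.
  have hPy : ∀ n, ε • P n ≤ y n := by
    intro n
    have h1 : (y n - ε • a)⁻ ⊓ P n = 0 := by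
      refine (hP n).inf_eq_zero (hv0 n) (hy0 0) (negPart_nonneg _) ?_
      rw [inf_comm]
      exact posPart_inf_negPart_eq_zero _
    rw [inf_comm] at h1
    have h2 := smul_inf_eq_zero hε.le (hP0 n) (negPart_nonneg _) h1
    have h3 : (ε • P n - y n)⁺ ≤ 0 := by
      rw [← h2]
      refine le_inf (sup_le (sub_le_self _ (hy0 n)) (smul_nonneg hε.le (hP0 n))) ?_
      refine sup_le ?_ (negPart_nonneg _)
      rw [negPart_def, neg_sub]
      exact le_sup_of_le_left (sub_le_sub_right (smul_le_smul_of_nonneg_left (hP n).le hε.le) _)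
    exact sub_nonpos.1 ((le_posPart _).trans h3)
  -- The layers `d n` are disjoint, so the weighted `n • d n` have a supremum `u`. It dominates `k •
  -- (P k - P m)`, a sum of layers of index at least `k`.
  set d : ℕ → E := fun n => P n - P (n + 1)
  have hd0 : ∀ n, 0 ≤ d n := fun n => sub_nonneg.2 (hPanti n.le_succ)
  have hda : ∀ n, d n ≤ a - P (n + 1) := fun n => sub_le_sub_right (hP n).le _
  have hdd : ∀ m n, m < n → d m ⊓ d n = 0 := by
    intro m n hmn
    exact inf_eq_zero_of_le (hdis (m + 1) n hmn (d m) (hd0 m) (hda m)) (hd0 m) (hd0 n) le_rfl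
      (sub_le_self _ (hP0 _))
  have hnd : ∀ m n, m < n → (m • d m) ⊓ (n • d n) = 0 := by
    intro m n hmn
    refine inf_nsmul_eq_zero (nsmul_nonneg (hd0 m) m) (hd0 n) ?_ n
    rw [inf_comm]
    refine inf_nsmul_eq_zero (hd0 n) (hd0 m) ?_ m
    rw [inf_comm]
    exact hdd m n hmn
  obtain ⟨u, hu⟩ := hE_lat (Set.range fun n => n • d n) (Set.range_nonempty _)
    (Set.countable_range _) (by rintro _ ⟨n, rfl⟩; exact nsmul_nonneg (hd0 n) n) (by
      rintro _ ⟨m, rfl⟩ _ ⟨n, rfl⟩ hne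
      simp only [abs_of_nonneg (nsmul_nonneg (hd0 m) m), abs_of_nonneg (nsmul_nonneg (hd0 n) n)]
      rcases lt_trichotomy m n with h | h | h
      · exact hnd m n h
      · subst h; exact absurd rfl hne
      · rw [inf_comm]; exact hnd n m h)
  have hu' : ∀ n, n • d n ≤ u := fun n => hu.1 ⟨n, rfl⟩
  have hu0 : 0 ≤ u := by simpa using hu' 0
  refine ⟨u, fun k => ?_⟩
  have hsum : ∀ m, k ≤ m → k • (P k - P m) ≤ u := by
    intro m hm
    induction m, hm using Nat.le_induction with
    | base => simpa using hu0
    | succ m hm ih =>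
      have h1 : k • (P k - P (m + 1)) = k • (P k - P m) + k • d m := by
        rw [← nsmul_add]; congr 1; simp only [d]; abel
      rw [h1]
      refine add_le_of_inf_eq_zero ?_ ih ((nsmul_le_nsmul_left (hd0 m) hm).trans (hu' m))
      have hPk : 0 ≤ P k - P m := sub_nonneg.2 (hPanti hm)
      refine inf_nsmul_eq_zero (nsmul_nonneg hPk k) (hd0 m) ?_ k
      rw [inf_comm]
      refine inf_nsmul_eq_zero (hd0 m) hPk ?_ k
      rw [inf_comm]
      exact inf_eq_zero_of_le (hdis m m le_rfl _ hPk (sub_le_sub_right (hP k).le _)) hPk (hd0 m)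
        le_rfl (sub_le_self _ (hP0 _))
  -- Letting `m` grow: `k • P k - u ≤ k • P m`, which is at most a fixed multiple of `y m`, and the
  -- infimum of the `y m` is `0`.
  have hkP : k • P k ≤ u := by
    rcases Nat.eq_zero_or_pos k with rfl | hk
    · simpa using hu0
    have hk' : (0 : ℝ) < k := by exact_mod_cast hk
    have h1 : ∀ m, k ≤ m → k • P k - u ≤ (k * ε⁻¹ : ℝ) • y m := by
      intro m hm
      have h2 : k • P k - u ≤ k • P m := by
        have := hsum m hm
        rw [nsmul_sub] at this
        rw [sub_le_comm]; exact this
      refine h2.trans ?_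
      rw [← Nat.cast_smul_eq_nsmul ℝ, mul_smul]
      refine smul_le_smul_of_nonneg_left ?_ hk'.le
      rw [← inv_smul_smul₀ hε.ne' (P m)]
      exact smul_le_smul_of_nonneg_left (hPy m) (inv_nonneg.2 hε.le)
    have hc : (0 : ℝ) < k * ε⁻¹ := by positivity
    have h2 : (k * ε⁻¹ : ℝ)⁻¹ • (k • P k - u) ≤ 0 := by
      refine h0.2 ?_
      rintro _ ⟨m, rfl⟩
      have h3 := h1 (max k m) (le_max_left _ _)
      calc (k * ε⁻¹ : ℝ)⁻¹ • (k • P k - u)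
          ≤ (k * ε⁻¹ : ℝ)⁻¹ • ((k * ε⁻¹ : ℝ) • y (max k m)) :=
            smul_le_smul_of_nonneg_left h3 (inv_nonneg.2 hc.le)
        _ = y (max k m) := inv_smul_smul₀ hc.ne' _
        _ ≤ y m := hy (le_max_right _ _)
    have h3 := smul_le_smul_of_nonneg_left h2 hc.le
    rw [smul_inv_smul₀ hc.ne', smul_zero] at h3
    exact sub_nonpos.1 h3
  refine le_trans (nsmul_le_nsmul_right ?_ k) hkP
  refine le_trans (le_inf ?_ ?_) ((hP k).inf_le 1)
  · exact sup_le ((sub_le_self _ hεa).trans (hy (Nat.zero_le k))) (hy0 0)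
  · rw [one_nsmul]

/-- A solid seminorm on a universally `σ`-complete space is `σ`-order continuous. -/
theorem IsSolidSeminorm.exists_lt (hE_ded : DedekindSigmaComplete E)
    (hE_lat : LaterallySigmaComplete E) {p : Seminorm ℝ E} (hp : IsSolidSeminorm p)
    {y : ℕ → E} (hy : Antitone y) (h0 : IsGLB (Set.range y) 0) {δ : ℝ} (hδ : 0 < δ) :
    ∃ n, p (y n) < δ := by
  have hy0 : ∀ n, 0 ≤ y n := fun n => h0.1 ⟨n, rfl⟩
  -- Chosen so that `p (ε • y 0) < δ / 2`; the `+ 1` keeps the denominator positive. The remaining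
  -- part of `y n` has `p`-value at most `p u / n`.
  set ε : ℝ := δ / (2 * (p (y 0) + 1))
  have hpos : 0 < p (y 0) + 1 := by have := apply_nonneg p (y 0); linarith
  have hε : 0 < ε := by positivity
  obtain ⟨u, hu⟩ := exists_forall_nsmul_posPart_le hE_ded hE_lat hy h0 hε
  obtain ⟨n, hn⟩ := exists_nat_gt (2 * p u / δ)
  have hn0 : (0 : ℝ) < n := lt_of_le_of_lt (by have := apply_nonneg p u; positivity) hn
  refine ⟨n, ?_⟩
  have h1 : p (y n) ≤ p (ε • y 0) + p ((y n - ε • y 0)⁺) := by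
    refine (hp.mono (hy0 n) ?_).trans (map_add_le_add p _ _)
    exact sub_le_iff_le_add'.1 (le_posPart _)
  have h2 : n * p ((y n - ε • y 0)⁺) ≤ p u := by
    have := hp.mono (nsmul_nonneg (posPart_nonneg _) n) (hu n)
    rwa [← Nat.cast_smul_eq_nsmul ℝ, map_smul_eq_mul, Real.norm_natCast] at this
  have h3 : p (ε • y 0) < δ / 2 := by
    rw [map_smul_eq_mul, Real.norm_of_nonneg hε.le]
    have : ε * (p (y 0) + 1) = δ / 2 := by simp only [ε]; field_simp
    nlinarith
  have h4 : p ((y n - ε • y 0)⁺) < δ / 2 := by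
    rw [div_lt_iff₀ hδ] at hn
    by_contra! h
    nlinarith
  linarith

/-- Real lattice homomorphisms. -/
def IsLatHom (φ : E →ₗ[ℝ] ℝ) : Prop := ∀ x, φ |x| = |φ x|

namespace IsLatHom

variable {φ : E →ₗ[ℝ] ℝ}

theorem nonneg (h : IsLatHom φ) {x : E} (hx : 0 ≤ x) : 0 ≤ φ x := by
  rw [← abs_of_nonneg hx, h]; exact abs_nonneg _

theorem mono (h : IsLatHom φ) {x y : E} (hxy : x ≤ y) : φ x ≤ φ y := by
  have := h.nonneg (sub_nonneg.2 hxy)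
  rwa [map_sub, sub_nonneg] at this

theorem map_inf (h : IsLatHom φ) (x y : E) : φ (x ⊓ y) = φ x ⊓ φ y := by
  rw [inf_eq_half_smul_add_sub_abs_sub ℝ x y, inf_eq_half_smul_add_sub_abs_sub ℝ (φ x) (φ y),
    map_smul, map_sub, map_add, h, map_sub]

theorem isSolidSeminorm (h : IsLatHom φ) : IsSolidSeminorm ((normSeminorm ℝ ℝ).comp φ) := by
  intro x y hxy
  have := h.mono hxy
  simpa [h x, h y] using this

/-- Real lattice homomorphisms on a universally `σ`-complete space are `σ`-`uo`-continuous. -/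
theorem tendsto_of_uoTendsto (hE_ded : DedekindSigmaComplete E)
    (hE_lat : LaterallySigmaComplete E) (h : IsLatHom φ) {x : ℕ → E} (hx : UoTendsto x 0) :
    Tendsto (fun n => φ (x n)) atTop (𝓝 0) := by
  rw [Metric.tendsto_atTop']
  by_contra! hcon
  obtain ⟨δ, hδ, hfreq⟩ := hcon
  obtain ⟨g, hg, hgδ⟩ := extraction_of_frequently_atTop (P := fun n => δ ≤ dist (φ (x n)) 0)
    (frequently_atTop'.2 hfreq)
  -- Running infima turn the bad subsequence into a decreasing one. Homomorphisms preserve finite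
  -- infima, so `φ (y n)` stays above `δ`, while `uo`-convergence tested against `|x (g 0)|` forces
  -- `y` down to `0`.
  let y : ℕ → E := fun n => Nat.rec |x (g 0)| (fun n z => z ⊓ |x (g (n + 1))|) n
  have hys : ∀ n, y (n + 1) = y n ⊓ |x (g (n + 1))| := fun n => rfl
  have hanti : Antitone y := antitone_nat_of_succ_le fun n => inf_le_left
  have hyx : ∀ n, y n ≤ |x (g n)| := by
    rintro (_ | n)
    · exact le_rfl
    · exact inf_le_right
  have hy0 : ∀ n, 0 ≤ y n := by
    intro n
    induction n with
    | zero => exact abs_nonneg _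
    | succ n ih => exact le_inf ih (abs_nonneg _)
  have hφx : ∀ n, δ ≤ φ |x (g n)| := by
    intro n
    have := hgδ n
    rwa [Real.dist_eq, sub_zero, ← h] at this
  have hφy : ∀ n, δ ≤ φ (y n) := by
    intro n
    induction n with
    | zero => exact hφx 0
    | succ n ih => rw [hys, h.map_inf]; exact le_inf ih (hφx _)
  have hglb : IsGLB (Set.range y) 0 := by
    refine ⟨by rintro _ ⟨n, rfl⟩; exact hy0 n, fun l hl => ?_⟩
    obtain ⟨Z, -, -, hZ, hxZ⟩ := hx |x (g 0)| (abs_nonneg _)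
    refine hZ.2 fun z hz => ?_
    obtain ⟨i₀, hi⟩ := hxZ z hz
    have h1 := (hi (g i₀) (hg.le_apply)).2
    simp only [sub_zero] at h1
    exact (hl ⟨i₀, rfl⟩).trans ((le_inf (hyx i₀) (hanti (Nat.zero_le i₀))).trans h1)
  obtain ⟨n, hn⟩ := h.isSolidSeminorm.exists_lt hE_ded hE_lat hanti hglb hδ
  have : φ (y n) < δ := lt_of_le_of_lt (le_abs_self _) (by simpa using hn)
  exact absurd (hφy n) (not_le.2 this)

end IsLatHom

theorem uoTendsto_of_ordTendsto {ι : Type w} [Preorder ι] {x : ι → E} (hx : OrdTendsto x 0) :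
    UoTendsto x 0 := by
  intro y hy
  rw [ordTendsto_iff_abs] at hx ⊢
  obtain ⟨Z, h1, h2, h3, h4⟩ := hx
  refine ⟨Z, h1, h2, h3, fun z hz => ?_⟩
  obtain ⟨i₀, hi⟩ := h4 z hz
  refine ⟨i₀, fun i hii => ?_⟩
  rw [sub_zero, abs_of_nonneg (le_inf (abs_nonneg _) hy)]
  exact inf_le_left.trans (hi i hii)

end RieszSpace

/-! ### Atoms modulo the kernel of a solid seminorm. -/

section SolidSeminorm

variable {E : Type u} [AddCommGroup E] [Lattice E] [IsOrderedAddMonoid E]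
  [Module ℝ E] [IsOrderedModule ℝ E] {p : Seminorm ℝ E}

namespace IsSolidSeminorm

theorem eq_zero_of_le (hp : IsSolidSeminorm p) {x y : E} (hx : 0 ≤ x) (hxy : x ≤ y)
    (hy : p y = 0) : p x = 0 :=
  le_antisymm ((hp.mono hx hxy).trans hy.le) (apply_nonneg p x)

theorem inf_add_le (hp : IsSolidSeminorm p) {x y z : E} (hx : 0 ≤ x) (hy : 0 ≤ y) (hz : 0 ≤ z) :
    p (x ⊓ (y + z)) ≤ p (x ⊓ y) + p (x ⊓ z) :=
  (hp.mono (le_inf hx (add_nonneg hy hz)) (inf_add_le_inf_add_inf hx hy hz)).trans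
    (map_add_le_add p _ _)

theorem inf_add_eq_zero (hp : IsSolidSeminorm p) {x y z : E} (hx : 0 ≤ x) (hy : 0 ≤ y)
    (hz : 0 ≤ z) (h : p (x ⊓ y) = 0) (h' : p (x ⊓ z) = 0) : p (x ⊓ (y + z)) = 0 :=
  le_antisymm ((hp.inf_add_le hx hy hz).trans (by simp [h, h'])) (apply_nonneg p _)

theorem inf_nsmul_eq_zero (hp : IsSolidSeminorm p) {x y : E} (hx : 0 ≤ x) (hy : 0 ≤ y)
    (h : p (x ⊓ y) = 0) (k : ℕ) : p (x ⊓ k • y) = 0 := by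
  induction k with
  | zero => simp [hx]
  | succ k ih =>
    rw [succ_nsmul]
    exact hp.inf_add_eq_zero hx (nsmul_nonneg hy k) hy ih h

theorem inf_smul_eq_zero (hp : IsSolidSeminorm p) {x y : E} (hx : 0 ≤ x) (hy : 0 ≤ y)
    (h : p (x ⊓ y) = 0) {r : ℝ} (hr : 0 ≤ r) : p (x ⊓ r • y) = 0 := by
  obtain ⟨n, hn⟩ := exists_nat_ge r
  refine hp.eq_zero_of_le (le_inf hx (smul_nonneg hr hy)) (inf_le_inf_left x ?_)
    (hp.inf_nsmul_eq_zero hx hy h n)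
  rw [← Nat.cast_smul_eq_nsmul ℝ]
  exact smul_le_smul_of_nonneg_right hn hy

/-- On a universally `σ`-complete space, a solid seminorm vanishes somewhere on every sequence
that is disjoint up to its kernel. -/
theorem exists_eq_zero_of_pairwise (hE_ded : DedekindSigmaComplete E)
    (hE_lat : LaterallySigmaComplete E) (hp : IsSolidSeminorm p) {x : ℕ → E}
    (hx : ∀ n, 0 ≤ x n) (hdis : ∀ m n, m < n → p (x m ⊓ x n) = 0) : ∃ n, p (x n) = 0 := by
  by_contra! hne
  set s : ℕ → E := fun n => ∑ m ∈ Finset.range n, x m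
  have hs : ∀ n, 0 ≤ s n := fun n => Finset.sum_nonneg fun m _ => hx m
  have hxs : ∀ n m, m ≤ n → p (x n ⊓ s m) = 0 := by
    intro n m hmn
    induction m with
    | zero => simp [s, hx]
    | succ m ih =>
      simp only [s, Finset.sum_range_succ]
      refine hp.inf_add_eq_zero (hx n) (hs m) (hx m) (ih (by omega)) ?_
      rw [inf_comm]; exact hdis m n (by omega)
  -- Removing from `x n` its component along the earlier terms makes the sequence truly disjoint.
  -- Nothing is lost for `p`: it vanishes on each `x n ⊓ k • s n`, hence on `P n` by `σ`-order
  -- continuity.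
  choose P hP using fun n => IsComponent.exists_isComponent hE_ded (s n) (x n)
  have hpP : ∀ n, p (P n) = 0 := by
    intro n
    refine le_antisymm (le_of_forall_pos_le_add fun δ hδ => ?_) (apply_nonneg p _)
    have hanti : Antitone fun k : ℕ => P n - x n ⊓ k • s n := fun k l hkl =>
      sub_le_sub_left (inf_le_inf_left _ (nsmul_le_nsmul_left (hs n) hkl)) _
    have hglb : IsGLB (Set.range fun k : ℕ => P n - x n ⊓ k • s n) 0 := by
      refine ⟨by rintro _ ⟨k, rfl⟩; exact sub_nonneg.2 ((hP n).inf_le k), fun l hl => ?_⟩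
      have : P n ≤ P n - l := by
        refine (hP n).2 ?_
        rintro _ ⟨k, rfl⟩
        have := hl ⟨k, rfl⟩
        rwa [le_sub_comm]
      simpa using this
    obtain ⟨k, hk⟩ := hp.exists_lt hE_ded hE_lat hanti hglb hδ
    have h1 := map_add_le_add p (P n - x n ⊓ k • s n) (x n ⊓ k • s n)
    rw [sub_add_cancel, hp.inf_nsmul_eq_zero (hx n) (hs n) (hxs n n le_rfl)] at h1
    linarith
  set q : ℕ → E := fun n => x n - P n
  have hq0 : ∀ n, 0 ≤ q n := fun n => sub_nonneg.2 (hP n).le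
  have hpq : ∀ n, 0 < p (q n) := by
    intro n
    have h1 := map_add_le_add p (q n) (P n)
    simp only [q, sub_add_cancel, hpP, add_zero] at h1
    exact lt_of_lt_of_le (lt_of_le_of_ne (apply_nonneg p _) (hne n).symm) h1
  have hqq : ∀ m n, m < n → q m ⊓ q n = 0 := by
    intro m n hmn
    rw [inf_comm]
    refine inf_eq_zero_of_le ((hP n).sub_inf_eq_zero (hs n)) (hq0 n) (hq0 m) le_rfl ?_
    refine (sub_le_self _ ((hP m).nonneg (hx m))).trans ?_
    exact Finset.single_le_sum (fun i _ => hx i) (Finset.mem_range.2 hmn)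
  -- Normalised so that `p (c n • q n) = n`, which no single upper bound can accommodate.
  set c : ℕ → ℝ := fun n => n / p (q n)
  have hc : ∀ n, 0 ≤ c n := fun n => by have := hpq n; positivity
  have hcq : ∀ n, 0 ≤ c n • q n := fun n => smul_nonneg (hc n) (hq0 n)
  have hcc : ∀ m n, m < n → (c m • q m) ⊓ (c n • q n) = 0 := by
    intro m n hmn
    refine smul_inf_eq_zero (hc m) (hq0 m) (hcq n) ?_
    rw [inf_comm]
    refine smul_inf_eq_zero (hc n) (hq0 n) (hq0 m) ?_
    rw [inf_comm]
    exact hqq m n hmn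
  obtain ⟨u, hu⟩ := hE_lat (Set.range fun n => c n • q n) (Set.range_nonempty _)
    (Set.countable_range _) (by rintro _ ⟨n, rfl⟩; exact hcq n) (by
      rintro _ ⟨m, rfl⟩ _ ⟨n, rfl⟩ hne
      simp only [abs_of_nonneg (hcq m), abs_of_nonneg (hcq n)]
      rcases lt_trichotomy m n with h | h | h
      · exact hcc m n h
      · subst h; exact absurd rfl hne
      · rw [inf_comm]; exact hcc n m h)
  obtain ⟨n, hn⟩ := exists_nat_gt (p u)
  have h1 := hp.mono (hcq n) (hu.1 ⟨n, rfl⟩)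
  rw [map_smul_eq_mul, Real.norm_of_nonneg (hc n), div_mul_cancel₀ _ (hpq n).ne'] at h1
  exact absurd hn (not_lt.2 h1)

end IsSolidSeminorm

/-- `a` represents an atom of the quotient by the kernel of `p`. -/
structure IsAtomModKer (p : Seminorm ℝ E) (a : E) : Prop where
  nonneg : 0 ≤ a
  ne_zero : p a ≠ 0
  eq_zero_or : ∀ y z, 0 ≤ y → 0 ≤ z → y ≤ a → z ≤ a → p (y ⊓ z) = 0 → p y = 0 ∨ p z = 0

/-- Without an atom below `x`, every non-null piece splits into two non-null pieces disjoint modulo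
the kernel. Splitting the second piece forever and collecting the first ones gives a sequence
excluded by `exists_eq_zero_of_pairwise`. -/
theorem exists_isAtomModKer_le (hE_ded : DedekindSigmaComplete E)
    (hE_lat : LaterallySigmaComplete E) (hp : IsSolidSeminorm p) {x : E} (hx : 0 ≤ x)
    (hpx : p x ≠ 0) : ∃ a, IsAtomModKer p a ∧ a ≤ x := by
  by_contra! hcon
  have hsplit : ∀ a : {a : E // 0 ≤ a ∧ a ≤ x ∧ p a ≠ 0}, ∃ b c : {a : E // 0 ≤ a ∧ a ≤ x ∧ p a ≠ 0},
      b.1 ≤ a.1 ∧ c.1 ≤ a.1 ∧ p (b.1 ⊓ c.1) = 0 := by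
    rintro ⟨a, ha, hax, hpa⟩
    by_contra! h
    refine hcon a ⟨ha, hpa, fun y z hy hz hya hza hyz => ?_⟩ hax
    by_contra! hne
    exact h ⟨y, hy, hya.trans hax, hne.1⟩ ⟨z, hz, hza.trans hax, hne.2⟩ hya hza hyz
  choose f g hf hg hfg using hsplit
  set Z : ℕ → {a : E // 0 ≤ a ∧ a ≤ x ∧ p a ≠ 0} := fun n => g^[n] ⟨x, hx, le_rfl, hpx⟩
  have hZs : ∀ n, Z (n + 1) = g (Z n) := fun n => Function.iterate_succ_apply' _ _ _
  have hZ : Antitone fun n => (Z n).1 := antitone_nat_of_succ_le fun n => by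
    rw [hZs]; exact hg _
  obtain ⟨n, hn⟩ := hp.exists_eq_zero_of_pairwise hE_ded hE_lat (x := fun n => (f (Z n)).1)
    (fun n => (f (Z n)).2.1) (fun m n hmn => by
      refine hp.eq_zero_of_le (le_inf (f (Z m)).2.1 (f (Z n)).2.1) (inf_le_inf_left _ ?_)
        (hfg (Z m))
      rw [← hZs]
      exact (hf _).trans (hZ hmn))
  exact (f (Z n)).2.2.2 hn

namespace IsAtomModKer

variable {a : E}

theorem smul_inf_ne_zero (hp : IsSolidSeminorm p) (ha : IsAtomModKer p a) {t : ℝ} (ht : 0 < t) :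
    p ((t • a) ⊓ a) ≠ 0 := by
  intro h
  have hm : 0 < min t 1 := lt_min ht one_pos
  have h1 : p (min t 1 • a) = 0 := by
    refine hp.eq_zero_of_le (smul_nonneg hm.le ha.nonneg) (le_inf ?_ ?_) h
    · exact smul_le_smul_of_nonneg_right (min_le_left _ _) ha.nonneg
    · conv_rhs => rw [← one_smul ℝ a]
      exact smul_le_smul_of_nonneg_right (min_le_right _ _) ha.nonneg
  rw [map_smul_eq_mul] at h1
  rcases mul_eq_zero.1 h1 with h1 | h1
  · exact hm.ne' (norm_eq_zero.1 h1)
  · exact ha.ne_zero h1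

/-- The two residuals are disjoint from `a` modulo the kernel, and their sum dominates `|c - d| •
a`. -/
theorem coeff_unique (hp : IsSolidSeminorm p) (ha : IsAtomModKer p a) {x : E} {c d : ℝ}
    (hc : p (a ⊓ |x - c • a|) = 0) (hd : p (a ⊓ |x - d • a|) = 0) : c = d := by
  by_contra hne
  refine ha.smul_inf_ne_zero hp (abs_pos.2 (sub_ne_zero.2 hne)) ?_
  rw [inf_comm]
  refine hp.eq_zero_of_le (le_inf ha.nonneg (smul_nonneg (abs_nonneg _) ha.nonneg))
    (inf_le_inf_left a ?_) (hp.inf_add_eq_zero ha.nonneg (abs_nonneg _) (abs_nonneg _) hc hd)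
  calc |c - d| • a = |(x - d • a) - (x - c • a)| := by
        rw [← abs_of_nonneg ha.nonneg, ← abs_smul_eq, abs_of_nonneg ha.nonneg, sub_smul]
        congr 1; abel
    _ ≤ |x - c • a| + |x - d • a| := by
        rw [add_comm, sub_eq_add_neg (x - d • a), ← abs_neg (x - c • a)]
        exact abs_add_le _ _

/-- The upper half of the Dedekind cut that defines the coefficient of `x` along `a`. -/
def upperCut (p : Seminorm ℝ E) (a x : E) : Set ℝ := {c | p (a ⊓ (x - c • a)⁺) = 0}

/-- The positive and negative parts of `x - c • a`, truncated at `a`, are disjoint elements of `[0,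
a]`, so atomicity makes one of them null. -/
theorem mem_upperCut_or (ha : IsAtomModKer p a) (x : E) (c : ℝ) :
    c ∈ upperCut p a x ∨ -c ∈ upperCut p a (-x) := by
  refine ha.eq_zero_or _ _ (le_inf ha.nonneg (posPart_nonneg _))
    (le_inf ha.nonneg (posPart_nonneg _)) inf_le_left inf_le_left ?_
  have h : (-x - -c • a)⁺ = (x - c • a)⁻ := by
    rw [← posPart_neg]; congr 1; rw [neg_smul]; abel
  rw [h, inf_eq_zero_of_le (posPart_inf_negPart_eq_zero (x - c • a))
    (le_inf ha.nonneg (posPart_nonneg _)) (le_inf ha.nonneg (negPart_nonneg _))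
    inf_le_right inf_le_right, map_zero]

/-- If every `a ⊓ (x - n • a)⁻` were null, then `a` would be at most a null vector plus `n⁻¹ • x⁺`,
giving `n * p a ≤ p x⁺` for all large `n`. -/
theorem upperCut_nonempty (hp : IsSolidSeminorm p) (ha : IsAtomModKer p a) (x : E) :
    (upperCut p a x).Nonempty := by
  by_contra hne
  rw [Set.not_nonempty_iff_eq_empty] at hne
  have hL : ∀ c, -c ∈ upperCut p a (-x) := fun c =>
    (ha.mem_upperCut_or x c).resolve_left (by simp [hne])
  have hpa : 0 < p a := lt_of_le_of_ne (apply_nonneg p a) ha.ne_zero.symm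
  obtain ⟨n, hn⟩ := exists_nat_gt (p x⁺ / p a + 1)
  have hn1 : (1 : ℝ) < n := lt_of_le_of_lt (by
    have := apply_nonneg p x⁺
    have : 0 ≤ p x⁺ / p a := by positivity
    linarith) hn
  have hn0 : (0 : ℝ) < n := by linarith
  have hni : (n : ℝ)⁻¹ ≤ 1 := inv_le_one_of_one_le₀ hn1.le
  have h1 : a ≤ a ⊓ (-x - -(n : ℝ) • a)⁺ + (n : ℝ)⁻¹ • x⁺ := by
    rw [inf_add]
    have hx : 0 ≤ (n : ℝ)⁻¹ • x⁺ := smul_nonneg (inv_nonneg.2 hn0.le) (posPart_nonneg _)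
    refine le_inf (le_add_of_nonneg_right hx) ?_
    calc a = (n : ℝ)⁻¹ • (-x - -(n : ℝ) • a) + (n : ℝ)⁻¹ • x := by
          rw [← smul_add, neg_smul, show -x - -((n : ℝ) • a) + x = (n : ℝ) • a by abel,
            inv_smul_smul₀ hn0.ne']
      _ ≤ (n : ℝ)⁻¹ • (-x - -(n : ℝ) • a)⁺ + (n : ℝ)⁻¹ • x⁺ :=
          add_le_add (smul_le_smul_of_nonneg_left (le_posPart _) (inv_nonneg.2 hn0.le))
            (smul_le_smul_of_nonneg_left (le_posPart _) (inv_nonneg.2 hn0.le))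
      _ ≤ (-x - -(n : ℝ) • a)⁺ + (n : ℝ)⁻¹ • x⁺ := by
          gcongr
          conv_rhs => rw [← one_smul ℝ (-x - -(n : ℝ) • a)⁺]
          exact smul_le_smul_of_nonneg_right hni (posPart_nonneg _)
  have h2 := (hp.mono ha.nonneg h1).trans (map_add_le_add p _ _)
  rw [show p (a ⊓ (-x - -(n : ℝ) • a)⁺) = 0 from hL n, zero_add, map_smul_eq_mul,
    Real.norm_of_nonneg (inv_nonneg.2 hn0.le), inv_mul_eq_div, le_div_iff₀ hn0] at h2
  have h3 : p x⁺ / p a < n := by linarith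
  rw [div_lt_iff₀ hpa] at h3
  linarith

theorem neg_le_of_mem_upperCut (hp : IsSolidSeminorm p) (ha : IsAtomModKer p a) {x : E}
    {c d : ℝ} (hc : c ∈ upperCut p a x) (hd : d ∈ upperCut p a (-x)) : -d ≤ c := by
  by_contra! hlt
  have ht : 0 < -d - c := by linarith
  refine ha.smul_inf_ne_zero hp ht ?_
  rw [inf_comm]
  refine hp.eq_zero_of_le (le_inf ha.nonneg (smul_nonneg ht.le ha.nonneg))
    (inf_le_inf_left a ?_)
    (hp.inf_add_eq_zero ha.nonneg (posPart_nonneg _) (posPart_nonneg _) hc hd)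
  calc (-d - c) • a = (x - c • a) + (-x - d • a) := by rw [sub_smul, neg_smul]; abel
    _ ≤ _ := add_le_add (le_posPart _) (le_posPart _)

theorem mem_upperCut_of_forall_pos (hp : IsSolidSeminorm p) (ha : IsAtomModKer p a) {x : E}
    {c : ℝ} (h : ∀ ε > 0, ∃ d ∈ upperCut p a x, d ≤ c + ε) : c ∈ upperCut p a x := by
  refine le_antisymm (le_of_forall_pos_le_add fun ε hε => ?_) (apply_nonneg p _)
  have hpa : 0 < p a := lt_of_le_of_ne (apply_nonneg p a) ha.ne_zero.symm
  obtain ⟨d, hd, hdc⟩ := h (ε / p a) (by positivity)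
  have hε' : 0 ≤ (ε / p a) • a := smul_nonneg (by positivity) ha.nonneg
  have h1 : (x - c • a)⁺ ≤ (x - d • a)⁺ + (ε / p a) • a := by
    refine sup_le ?_ (add_nonneg (posPart_nonneg _) hε')
    calc x - c • a = (x - d • a) + (d - c) • a := by rw [sub_smul]; abel
      _ ≤ _ := add_le_add (le_posPart _)
        (smul_le_smul_of_nonneg_right (by linarith) ha.nonneg)
  calc p (a ⊓ (x - c • a)⁺) ≤ p (a ⊓ ((x - d • a)⁺ + (ε / p a) • a)) :=
        hp.mono (le_inf ha.nonneg (posPart_nonneg _)) (inf_le_inf_left a h1)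
    _ ≤ p (a ⊓ (x - d • a)⁺) + p (a ⊓ (ε / p a) • a) :=
        hp.inf_add_le ha.nonneg (posPart_nonneg _) hε'
    _ ≤ 0 + p ((ε / p a) • a) :=
        add_le_add (le_of_eq hd) (hp.mono (le_inf ha.nonneg hε') inf_le_right)
    _ = 0 + ε := by
        rw [map_smul_eq_mul, Real.norm_of_nonneg (by positivity), div_mul_cancel₀ _ hpa.ne']

/-- The cut contains its infimum `c`, and by the dichotomy `-c` lies in the cut of `-x`; so both
parts of `x - c • a` are disjoint from `a` modulo the kernel. -/
theorem exists_coeff (hp : IsSolidSeminorm p) (ha : IsAtomModKer p a) (x : E) :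
    ∃ c : ℝ, p (a ⊓ |x - c • a|) = 0 := by
  obtain ⟨d, hd⟩ := ha.upperCut_nonempty hp (-x)
  have hne := ha.upperCut_nonempty hp x
  have hbdd : BddBelow (upperCut p a x) := ⟨-d, fun c hc => ha.neg_le_of_mem_upperCut hp hc hd⟩
  set c := sInf (upperCut p a x)
  have h1 : c ∈ upperCut p a x := ha.mem_upperCut_of_forall_pos hp fun ε hε => by
    obtain ⟨d, hd, hlt⟩ := exists_lt_of_csInf_lt hne (lt_add_of_pos_right c hε)
    exact ⟨d, hd, hlt.le⟩
  have h2 : -c ∈ upperCut p a (-x) := ha.mem_upperCut_of_forall_pos hp fun ε hε => by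
    have : c - ε ∉ upperCut p a x := fun h => by
      have := csInf_le hbdd h
      simp only [c] at this
      linarith
    exact ⟨-(c - ε), (ha.mem_upperCut_or x (c - ε)).resolve_left this, by linarith⟩
  refine ⟨c, ?_⟩
  have h3 : (-x - -c • a)⁺ = (x - c • a)⁻ := by
    rw [← posPart_neg]; congr 1; rw [neg_smul]; abel
  have h2' : p (a ⊓ (x - c • a)⁻) = 0 := by rw [← h3]; exact h2
  rw [← posPart_add_negPart]
  exact hp.inf_add_eq_zero ha.nonneg (posPart_nonneg _) (negPart_nonneg _) h1 h2'

/-- By uniqueness of the coefficient, additivity, homogeneity and compatibility with the modulus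
only require checking that the expected value leaves a null residual. -/
theorem exists_latHom (hp : IsSolidSeminorm p) (ha : IsAtomModKer p a) :
    ∃ φ : E →ₗ[ℝ] ℝ, IsLatHom φ ∧ ∀ x c, φ x = c ↔ p (a ⊓ |x - c • a|) = 0 := by
  choose φ hφ using ha.exists_coeff hp
  have huniq : ∀ x c, p (a ⊓ |x - c • a|) = 0 → φ x = c := fun x c h =>
    ha.coeff_unique hp (hφ x) h
  refine ⟨⟨⟨φ, fun x y => huniq _ _ ?_⟩, fun r x => huniq _ _ ?_⟩, fun x => huniq _ _ ?_,
    fun x c => ⟨?_, huniq x c⟩⟩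
  · refine hp.eq_zero_of_le (le_inf ha.nonneg (abs_nonneg _)) (inf_le_inf_left a ?_)
      (hp.inf_add_eq_zero ha.nonneg (abs_nonneg _) (abs_nonneg _) (hφ x) (hφ y))
    refine le_trans (le_of_eq ?_) (abs_add_le _ _)
    rw [add_smul]; congr 1; abel
  · have h := hp.inf_smul_eq_zero ha.nonneg (abs_nonneg _) (hφ x) (abs_nonneg r)
    rwa [← abs_smul_eq, smul_sub, smul_smul] at h
  · refine hp.eq_zero_of_le (le_inf ha.nonneg (abs_nonneg _)) (inf_le_inf_left a ?_) (hφ x)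
    have h := abs_abs_sub_abs_le x (φ x • a)
    rwa [abs_smul_eq, abs_of_nonneg ha.nonneg] at h
  · rintro rfl
    exact hφ x

end IsAtomModKer

/-- Modulo the kernel of a solid seminorm, a universally `σ`-complete space is spanned by
finitely many atoms, and the coordinates are lattice homomorphisms. -/
theorem IsSolidSeminorm.exists_finite_repr (hE_ded : DedekindSigmaComplete E)
    (hE_lat : LaterallySigmaComplete E) (hp : IsSolidSeminorm p) :
    ∃ (s : Finset E) (φ : E → E →ₗ[ℝ] ℝ), (∀ a ∈ s, IsLatHom (φ a)) ∧
      ∀ x, p (x - ∑ a ∈ s, φ a x • a) = 0 := by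
  classical
  -- A maximal family of atoms, pairwise disjoint modulo the kernel. It is finite, since an infinite
  -- one would contain a forbidden sequence.
  obtain ⟨A, hA⟩ := zorn_subset {A : Set E | (∀ a ∈ A, IsAtomModKer p a) ∧
      A.Pairwise fun a b => p (a ⊓ b) = 0} (by
    intro c hc hchain
    refine ⟨⋃₀ c, ⟨?_, ?_⟩, fun s hs => Set.subset_sUnion_of_mem hs⟩
    · rintro a ⟨s, hs, has⟩
      exact (hc hs).1 a has
    · rw [Set.pairwise_sUnion hchain.directedOn]
      exact fun s hs => (hc hs).2)
  have hatom := hA.prop.1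
  have hpair := hA.prop.2
  have hfin : A.Finite := by
    by_contra hinf
    have e := Set.Infinite.natEmbedding A hinf
    obtain ⟨n, hn⟩ := hp.exists_eq_zero_of_pairwise hE_ded hE_lat (x := fun n => (e n).1)
      (fun n => (hatom _ (e n).2).nonneg) (fun m n hmn => hpair (e m).2 (e n).2 fun h =>
        hmn.ne (e.injective (Subtype.ext h)))
    exact (hatom _ (e n).2).ne_zero hn
  have hex : ∀ a, ∃ φ : E →ₗ[ℝ] ℝ, a ∈ A →
      IsLatHom φ ∧ ∀ x c, φ x = c ↔ p (a ⊓ |x - c • a|) = 0 := by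
    intro a
    by_cases ha : a ∈ A
    · obtain ⟨φ, h⟩ := (hatom a ha).exists_latHom hp
      exact ⟨φ, fun _ => h⟩
    · exact ⟨0, fun h => absurd h ha⟩
  choose φ hφ using hex
  refine ⟨hfin.toFinset, φ, fun a ha => (hφ a (hfin.mem_toFinset.1 ha)).1, fun x => ?_⟩
  set r := x - ∑ a ∈ hfin.toFinset, φ a x • a
  have hφab : ∀ a ∈ A, ∀ b ∈ A, φ a b = if b = a then 1 else 0 := by
    intro a ha b hb
    rw [(hφ a ha).2]
    split_ifs with h
    · subst h; simp [(hatom b hb).nonneg]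
    · rw [zero_smul, sub_zero, abs_of_nonneg (hatom b hb).nonneg]
      exact hpair ha hb (Ne.symm h)
  have hr : ∀ a ∈ A, p (a ⊓ |r|) = 0 := by
    intro a ha
    have h1 : φ a r = 0 := by
      simp only [r, map_sub, map_sum, map_smul, smul_eq_mul]
      rw [Finset.sum_eq_single a]
      · rw [hφab a ha a ha]; simp
      · intro b hb hba
        rw [hφab a ha b (hfin.mem_toFinset.1 hb), if_neg hba, mul_zero]
      · intro h; exact absurd (hfin.mem_toFinset.2 ha) h
    have := ((hφ a ha).2 r 0).1 h1
    rwa [zero_smul, sub_zero] at this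
  -- A non-null remainder would dominate an atom disjoint from all of `A` modulo the kernel, against
  -- maximality.
  by_contra hne
  have hne' : p |r| ≠ 0 := fun h =>
    hne (le_antisymm ((hp r |r| (by rw [abs_abs])).trans h.le) (apply_nonneg p _))
  obtain ⟨b, hb, hbr⟩ := exists_isAtomModKer_le hE_ded hE_lat hp (abs_nonneg r) hne'
  have hab : ∀ a ∈ A, p (a ⊓ b) = 0 := fun a ha =>
    hp.eq_zero_of_le (le_inf (hatom a ha).nonneg hb.nonneg) (inf_le_inf_left a hbr) (hr a ha)
  have hins : insert b A ⊆ A := hA.le_of_ge ⟨by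
      rintro a (rfl | ha)
      · exact hb
      · exact hatom a ha, by
      refine hpair.insert fun a ha _ => ⟨?_, hab a ha⟩
      rw [inf_comm]; exact hab a ha⟩ (Set.subset_insert _ _)
  have := hab b (hins (Set.mem_insert _ _))
  rw [inf_idem] at this
  exact hb.ne_zero this

end SolidSeminorm

/-! ### Order bounded operators have finite rank. -/

section NormedLattice

variable {E : Type u} [AddCommGroup E] [Lattice E] [IsOrderedAddMonoid E]
  [Module ℝ E] [IsOrderedModule ℝ E]
  {F : Type v} [NormedAddCommGroup F] [Lattice F] [IsOrderedAddMonoid F] [HasSolidNorm F]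
  [NormedSpace ℝ F] [IsOrderedModule ℝ F]

theorem norm_le_of_mem_Icc {c d x : F} (hx : x ∈ Set.Icc c d) : ‖x‖ ≤ ‖|c| + |d|‖ := by
  refine norm_le_norm_of_abs_le_abs ?_
  rw [abs_of_nonneg (add_nonneg (abs_nonneg c) (abs_nonneg d)), abs_le']
  exact ⟨hx.2.trans ((le_abs_self d).trans (le_add_of_nonneg_left (abs_nonneg c))),
    (neg_le_neg hx.1).trans ((neg_le_abs c).trans (le_add_of_nonneg_right (abs_nonneg d)))⟩

/-- An order bounded operator into a normed lattice is dominated by a solid seminorm. -/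
theorem IsOrderBounded.exists_seminorm {T : E →ₗ[ℝ] F} (hT : IsOrderBounded T) :
    ∃ p : Seminorm ℝ E, IsSolidSeminorm p ∧ ∀ x, p x = 0 → T x = 0 := by
  let q : E → ℝ := fun x => sSup ((fun y => ‖T y‖) '' Set.Icc 0 |x|)
  have hbdd : ∀ x : E, BddAbove ((fun y => ‖T y‖) '' Set.Icc 0 |x|) := by
    intro x
    obtain ⟨c, d, h⟩ := hT 0 |x|
    refine ⟨‖|c| + |d|‖, ?_⟩
    rintro _ ⟨y, hy, rfl⟩
    exact norm_le_of_mem_Icc (h ⟨y, hy, rfl⟩)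
  have hle : ∀ x y : E, 0 ≤ y → y ≤ |x| → ‖T y‖ ≤ q x := fun x y h0 h =>
    le_csSup (hbdd x) ⟨y, ⟨h0, h⟩, rfl⟩
  have hsup : ∀ (x : E) (M : ℝ), (∀ y, 0 ≤ y → y ≤ |x| → ‖T y‖ ≤ M) → q x ≤ M := by
    intro x M h
    refine csSup_le (Set.Nonempty.image _ ⟨0, le_rfl, abs_nonneg x⟩) ?_
    rintro _ ⟨y, hy, rfl⟩
    exact h y hy.1 hy.2
  have hq0 : q 0 = 0 := by
    refine le_antisymm (hsup 0 0 fun y h0 h => ?_) (by simpa using hle 0 0 le_rfl (by simp))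
    rw [abs_zero] at h
    simp [le_antisymm h h0]
  have hadd : ∀ x y, q (x + y) ≤ q x + q y := by
    intro x y
    refine hsup _ _ fun z h0 h => ?_
    -- Riesz decomposition of `z ≤ |x| + |y|` into a part below `|x|` and a part below `|y|`.
    have h1 : ‖T (z ⊓ |x|)‖ ≤ q x := hle x _ (le_inf h0 (abs_nonneg x)) inf_le_right
    have h2 : ‖T (z - z ⊓ |x|)‖ ≤ q y := by
      refine hle y _ (sub_nonneg.2 inf_le_left) ?_
      rw [sub_le_comm]
      refine le_inf (sub_le_self _ (abs_nonneg y)) ?_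
      rw [sub_le_iff_le_add]
      exact h.trans (abs_add_le x y)
    calc ‖T z‖ = ‖T (z ⊓ |x|) + T (z - z ⊓ |x|)‖ := by rw [← map_add]; congr 2; abel
      _ ≤ q x + q y := (norm_add_le _ _).trans (add_le_add h1 h2)
  have hsmul : ∀ (r : ℝ) x, q (r • x) ≤ ‖r‖ * q x := by
    intro r x
    rcases eq_or_ne r 0 with rfl | hr
    · simp [hq0]
    have hr' : 0 < |r| := abs_pos.2 hr
    refine hsup _ _ fun z h0 h => ?_
    rw [abs_smul_eq] at h
    have h1 : ‖T (|r|⁻¹ • z)‖ ≤ q x := by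
      refine hle x _ (smul_nonneg (inv_nonneg.2 hr'.le) h0) ?_
      rw [← inv_smul_smul₀ hr'.ne' |x|]
      exact smul_le_smul_of_nonneg_left h (inv_nonneg.2 hr'.le)
    rw [map_smul, norm_smul, Real.norm_of_nonneg (inv_nonneg.2 hr'.le),
      inv_mul_le_iff₀ hr'] at h1
    exact h1
  refine ⟨Seminorm.ofSMulLE q hq0 hadd hsmul, fun x y hxy => ?_, fun x hx => ?_⟩
  · exact hsup x (q y) fun z h0 h => hle y z h0 (h.trans hxy)
  · have hx : q x = 0 := hx
    have h1 := hle x x⁺ (posPart_nonneg x) (sup_le (le_abs_self x) (abs_nonneg x))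
    have h2 := hle x x⁻ (negPart_nonneg x) (sup_le (neg_le_abs x) (abs_nonneg x))
    rw [hx] at h1 h2
    rw [← posPart_sub_negPart x, map_sub, norm_le_zero_iff.1 h1, norm_le_zero_iff.1 h2, sub_zero]

/-- Order bounded operators from a universally `σ`-complete space to a normed lattice have
finite rank, with lattice homomorphisms as coordinates. -/
theorem IsOrderBounded.exists_finite_repr (hE_ded : DedekindSigmaComplete E)
    (hE_lat : LaterallySigmaComplete E) {T : E →ₗ[ℝ] F} (hT : IsOrderBounded T) :
    ∃ (s : Finset E) (φ : E → E →ₗ[ℝ] ℝ), (∀ a ∈ s, IsLatHom (φ a)) ∧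
      T = ∑ a ∈ s, (φ a).smulRight (T a) := by
  obtain ⟨p, hp, hpT⟩ := hT.exists_seminorm
  obtain ⟨s, φ, hφ, h⟩ := hp.exists_finite_repr hE_ded hE_lat
  refine ⟨s, φ, hφ, LinearMap.ext fun x => ?_⟩
  have := hpT _ (h x)
  rw [map_sub, map_sum, sub_eq_zero] at this
  simpa [LinearMap.sum_apply] using this

end NormedLattice

theorem IsVectorLattice.of_linearEquiv {V : Type u} [AddCommGroup V] [Preorder V] [Module ℝ V]
    {W : Type v} [AddCommGroup W] [Lattice W] [IsOrderedAddMonoid W] [Module ℝ W]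
    [PosSMulMono ℝ W] (e : V ≃ₗ[ℝ] W) (he : ∀ x y, x ≤ y ↔ e x ≤ e y) :
    IsVectorLattice V where
  antisymm x y h h' := e.injective (le_antisymm ((he _ _).1 h) ((he _ _).1 h'))
  add_le_add_left x y z h := by
    rw [he, map_add, map_add]
    exact add_le_add le_rfl ((he _ _).1 h)
  smul_nonneg c x hc hx := by
    rw [he, map_zero] at hx ⊢
    rw [map_smul]
    exact _root_.smul_nonneg hc hx
  exists_sup x y := by
    refine ⟨e.symm (e x ⊔ e y), ?_, fun z hz => ?_⟩
    · rintro z (rfl | rfl) <;> simp [he]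
    · rw [he, e.apply_symm_apply]
      exact sup_le ((he _ _).1 (hz (by simp))) ((he _ _).1 (hz (by simp)))
  exists_inf x y := by
    refine ⟨e.symm (e x ⊓ e y), ?_, fun z hz => ?_⟩
    · rintro z (rfl | rfl) <;> simp [he]
    · rw [he, e.apply_symm_apply]
      exact le_inf ((he _ _).1 (hz (by simp))) ((he _ _).1 (hz (by simp)))

theorem isBand_top {V : Type u} [AddCommGroup V] [Preorder V] [Module ℝ V] :
    IsBand (⊤ : Submodule ℝ V) :=
  ⟨fun _ _ _ _ _ _ _ _ => Submodule.mem_top, fun _ _ _ _ _ _ _ _ => Submodule.mem_top⟩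

/-! ### Independence of real lattice homomorphisms on different rays. -/

section Rays

variable (E : Type u) [AddCommGroup E] [Lattice E] [IsOrderedAddMonoid E]
  [Module ℝ E] [IsOrderedModule ℝ E]

/-- Nonzero real lattice homomorphisms up to a positive factor. -/
def latHomSetoid : Setoid {φ : E →ₗ[ℝ] ℝ // IsLatHom φ ∧ φ ≠ 0} where
  r φ ψ := ∃ c : ℝ, 0 < c ∧ ψ.1 = c • φ.1
  iseqv :=
    { refl := fun φ => ⟨1, one_pos, (one_smul _ _).symm⟩
      symm := by
        rintro φ ψ ⟨c, hc, h⟩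
        exact ⟨c⁻¹, inv_pos.2 hc, by rw [h, inv_smul_smul₀ hc.ne']⟩
      trans := by
        rintro φ ψ χ ⟨c, hc, h⟩ ⟨d, hd, h'⟩
        exact ⟨d * c, mul_pos hd hc, by rw [h', h, mul_smul]⟩ }

/-- The rays of nonzero real lattice homomorphisms. -/
def LatHomRay : Type u := Quotient (latHomSetoid E)

variable {E}

namespace LatHomRay

/-- A representative of a ray. -/
noncomputable def hom (i : LatHomRay E) : E →ₗ[ℝ] ℝ := (Quotient.out i).1

theorem isLatHom (i : LatHomRay E) : IsLatHom i.hom := (Quotient.out i).2.1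

theorem hom_ne_zero (i : LatHomRay E) : i.hom ≠ 0 := (Quotient.out i).2.2

theorem exists_eq_smul {φ : E →ₗ[ℝ] ℝ} (h : IsLatHom φ) (h0 : φ ≠ 0) :
    ∃ (i : LatHomRay E) (c : ℝ), φ = c • i.hom := by
  obtain ⟨c, -, hc⟩ := @Quotient.mk_out _ (latHomSetoid E) ⟨φ, h, h0⟩
  exact ⟨@Quotient.mk _ (latHomSetoid E) ⟨φ, h, h0⟩, c, hc⟩

theorem eq_of_eq_smul {i j : LatHomRay E} {c : ℝ} (hc : 0 < c) (h : j.hom = c • i.hom) :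
    i = j := by
  have : (latHomSetoid E).r (Quotient.out i) (Quotient.out j) := ⟨c, hc, h⟩
  rw [← Quotient.out_eq i, ← Quotient.out_eq j]
  exact Quotient.sound this

theorem exists_hom_eq_one (i : LatHomRay E) : ∃ x : E, 0 ≤ x ∧ i.hom x = 1 := by
  obtain ⟨v, hv⟩ : ∃ v, i.hom v ≠ 0 := by
    by_contra! h
    exact i.hom_ne_zero (LinearMap.ext h)
  have h1 : 0 < i.hom |v| := by rw [i.isLatHom]; exact abs_pos.2 hv
  refine ⟨(i.hom |v|)⁻¹ • |v|, smul_nonneg (inv_nonneg.2 h1.le) (abs_nonneg v), ?_⟩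
  rw [map_smul, smul_eq_mul, inv_mul_cancel₀ h1.ne']

/-- If the kernel of `j.hom` lay in that of `i.hom`, the two would be proportional, with a positive
factor because both are positive and nonzero. Otherwise the modulus of a separating vector can be
normalised. -/
theorem exists_separating {i j : LatHomRay E} (hij : j ≠ i) :
    ∃ x : E, 0 ≤ x ∧ i.hom x = 1 ∧ j.hom x = 0 := by
  obtain ⟨w, hw, hw'⟩ : ∃ w, j.hom w = 0 ∧ i.hom w ≠ 0 := by
    by_contra! h
    obtain ⟨v, hv0, hv⟩ := j.exists_hom_eq_one
    have heq : i.hom = i.hom v • j.hom := by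
      ext x
      have := h (x - j.hom x • v) (by simp [hv])
      rw [map_sub, map_smul, sub_eq_zero] at this
      rw [this]; simp [mul_comm]
    refine hij (eq_of_eq_smul (lt_of_le_of_ne (i.isLatHom.nonneg hv0) fun h0 => ?_) heq)
    rw [← h0, zero_smul] at heq
    exact i.hom_ne_zero heq
  have h1 : 0 < i.hom |w| := by rw [i.isLatHom]; exact abs_pos.2 hw'
  refine ⟨(i.hom |w|)⁻¹ • |w|, smul_nonneg (inv_nonneg.2 h1.le) (abs_nonneg w), ?_, ?_⟩
  · rw [map_smul, smul_eq_mul, inv_mul_cancel₀ h1.ne']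
  · rw [map_smul, j.isLatHom, hw, abs_zero, smul_zero]

/-- Infima of separating vectors work, since homomorphisms preserve `⊓`. Positivity of `x` is what
later lets the operator order be read off coordinatewise. -/
theorem exists_dual (i : LatHomRay E) (s : Finset (LatHomRay E)) :
    ∃ x : E, 0 ≤ x ∧ i.hom x = 1 ∧ ∀ j ∈ s, j ≠ i → j.hom x = 0 := by
  classical
  induction s using Finset.induction_on with
  | empty =>
    obtain ⟨x, hx, h⟩ := i.exists_hom_eq_one
    exact ⟨x, hx, h, by simp⟩
  | insert k s _ ih =>
    obtain ⟨x, hx, hxi, hxs⟩ := ih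
    by_cases hki : k = i
    · refine ⟨x, hx, hxi, fun j hj hji => ?_⟩
      rcases Finset.mem_insert.1 hj with rfl | hj
      · exact absurd hki hji
      · exact hxs j hj hji
    · obtain ⟨w, hw, hwi, hwk⟩ := exists_separating hki
      refine ⟨x ⊓ w, le_inf hx hw, by rw [i.isLatHom.map_inf, hxi, hwi, inf_idem], ?_⟩
      intro j hj hji
      rw [j.isLatHom.map_inf]
      rcases Finset.mem_insert.1 hj with rfl | hj
      · rw [hwk]; exact inf_eq_right.2 (j.isLatHom.nonneg hx)
      · rw [hxs j hj hji]; exact inf_eq_left.2 (j.isLatHom.nonneg hw)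

end LatHomRay

end Rays

/-! ### `L_b(E, F)` as a direct sum of copies of `F`. -/

section NormedLattice

variable {E : Type u} [AddCommGroup E] [Lattice E] [IsOrderedAddMonoid E]
  [Module ℝ E] [IsOrderedModule ℝ E]
  {F : Type v} [NormedAddCommGroup F] [Lattice F] [IsOrderedAddMonoid F] [HasSolidNorm F]
  [NormedSpace ℝ F] [IsOrderedModule ℝ F]

theorem abs_sum_smul_le {α : Type*} (s : Finset α) (c : α → ℝ) (y : α → F) :
    |∑ a ∈ s, c a • y a| ≤ (∑ a ∈ s, |c a|) • ∑ a ∈ s, |y a| := by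
  rw [Finset.sum_smul]
  refine (Finset.le_sum_of_subadditive (fun y : F => |y|) abs_zero.le abs_add_le s _).trans (Finset.sum_le_sum fun a ha => ?_)
  rw [abs_smul_eq]
  exact smul_le_smul_of_nonneg_left
    (Finset.single_le_sum (f := fun a => |y a|) (fun b _ => abs_nonneg (y b)) ha) (abs_nonneg _)

theorem isOrderBounded_smulRight {φ : E →ₗ[ℝ] ℝ} (h : IsLatHom φ) (y : F) :
    IsOrderBounded (φ.smulRight y) := by
  intro a b
  refine ⟨-((|φ a| + |φ b|) • |y|), (|φ a| + |φ b|) • |y|, ?_⟩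
  rintro _ ⟨x, hx, rfl⟩
  have h1 : |φ x| ≤ |φ a| + |φ b| := by
    rw [abs_le]
    have ha := h.mono hx.1
    have hb := h.mono hx.2
    have := neg_abs_le (φ a)
    have := le_abs_self (φ b)
    have := abs_nonneg (φ a)
    have := abs_nonneg (φ b)
    constructor <;> linarith
  have h2 : |φ.smulRight y x| ≤ (|φ a| + |φ b|) • |y| := by
    rw [LinearMap.smulRight_apply, abs_smul_eq]
    exact smul_le_smul_of_nonneg_right h1 (abs_nonneg y)
  rw [abs_le'] at h2
  exact ⟨neg_le.1 h2.2, h2.1⟩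

/-- The Archimedean property, read off the solid norm: a lower bound `l` satisfies `‖l⁺‖ ≤ ε * ‖y‖`
for all `ε > 0`. -/
theorem isGLB_range_smul {y : F} (hy : 0 ≤ y) :
    IsGLB ((fun ε : ℝ => ε • y) '' Set.Ioi 0) 0 := by
  refine ⟨?_, fun l hl => ?_⟩
  · rintro _ ⟨ε, hε, rfl⟩
    exact smul_nonneg (le_of_lt hε) hy
  · have h1 : ∀ ε : ℝ, 0 < ε → ‖l⁺‖ ≤ ε * ‖y‖ := by
      intro ε hε
      have h0 : 0 ≤ ε • y := smul_nonneg hε.le hy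
      rw [← Real.norm_of_nonneg hε.le, ← norm_smul]
      refine norm_le_norm_of_abs_le_abs ?_
      rw [abs_of_nonneg (posPart_nonneg l), abs_of_nonneg h0]
      exact sup_le (hl ⟨ε, hε, rfl⟩) h0
    have h2 : ‖l⁺‖ ≤ 0 := by
      refine le_of_forall_pos_le_add fun δ hδ => ?_
      have hy1 : 0 < ‖y‖ + 1 := by positivity
      refine (h1 (δ / (‖y‖ + 1)) (by positivity)).trans ?_
      rw [zero_add, div_mul_eq_mul_div, div_le_iff₀ hy1]
      nlinarith
    exact posPart_eq_zero.1 (norm_le_zero_iff.1 h2)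

theorem IsOrderBounded.isSigmaUonContinuous (hE_ded : DedekindSigmaComplete E)
    (hE_lat : LaterallySigmaComplete E) {T : E →ₗ[ℝ] F} (hT : IsOrderBounded T) :
    IsSigmaUonContinuous T := by
  intro x hx
  obtain ⟨s, φ, hφ, hrepr⟩ := hT.exists_finite_repr hE_ded hE_lat
  rw [← tendsto_zero_iff_norm_tendsto_zero]
  have h : Tendsto (fun n => ∑ a ∈ s, φ a (x n) • T a) atTop (𝓝 (∑ a ∈ s, (0 : ℝ) • T a)) :=
    tendsto_finsetSum _ fun a ha =>
      ((hφ a ha).tendsto_of_uoTendsto hE_ded hE_lat hx).smul_const _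
  simp only [zero_smul, Finset.sum_const_zero] at h
  refine h.congr fun n => ?_
  conv_rhs => rw [hrepr]
  simp [LinearMap.sum_apply]

/-- The finitely many coordinates of `x n` tend to `0`, so `T (x n)` is eventually dominated by each
`ε • y`, where `y` is the sum of the `|T a|`. -/
theorem IsOrderBounded.isSigmaOrderContinuous (hE_ded : DedekindSigmaComplete E)
    (hE_lat : LaterallySigmaComplete E) {T : E →ₗ[ℝ] F} (hT : IsOrderBounded T) :
    IsSigmaOrderContinuous T := by
  intro x hx
  obtain ⟨s, φ, hφ, hrepr⟩ := hT.exists_finite_repr hE_ded hE_lat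
  rw [ordTendsto_iff_abs]
  set y : F := ∑ a ∈ s, |T a|
  have hy : 0 ≤ y := Finset.sum_nonneg fun a _ => abs_nonneg (T a)
  have h : Tendsto (fun n => ∑ a ∈ s, |φ a (x n)|) atTop (𝓝 (∑ a ∈ s, |(0 : ℝ)|)) :=
    tendsto_finsetSum _ fun a ha =>
      ((hφ a ha).tendsto_of_uoTendsto hE_ded hE_lat (uoTendsto_of_ordTendsto hx)).abs
  simp only [abs_zero, Finset.sum_const_zero] at h
  refine ⟨(fun ε : ℝ => ε • y) '' Set.Ioi 0, ⟨_, 1, Set.mem_Ioi.2 one_pos, rfl⟩, ?_, isGLB_range_smul hy, ?_⟩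
  · rintro _ ⟨ε, hε, rfl⟩ _ ⟨δ, hδ, rfl⟩
    exact ⟨_, ⟨min ε δ, Set.mem_Ioi.2 (lt_min hε hδ), rfl⟩, smul_le_smul_of_nonneg_right (min_le_left _ _) hy,
      smul_le_smul_of_nonneg_right (min_le_right _ _) hy⟩
  · rintro _ ⟨ε, hε, rfl⟩
    obtain ⟨n₀, hn⟩ := eventually_atTop.1 (h.eventually_lt_const hε)
    refine ⟨n₀, fun n hnn => ?_⟩
    rw [sub_zero, hrepr]
    simp only [LinearMap.sum_apply, LinearMap.smulRight_apply]
    exact (abs_sum_smul_le s _ _).trans (smul_le_smul_of_nonneg_right (hn n hnn).le hy)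

variable (E F) in
/-- The operator `x ↦ ∑ φ_i(x) f_i` attached to a finitely supported family `f`. -/
noncomputable def opOfFinsupp : (LatHomRay E →₀ F) →ₗ[ℝ] Lb E F :=
  LinearMap.codRestrict (Lb E F)
    (Finsupp.lsum ℝ fun i : LatHomRay E => LinearMap.smulRightₗ i.hom) fun f => by
      rw [Finsupp.lsum_apply]
      exact Submodule.sum_mem _ fun i _ => isOrderBounded_smulRight i.isLatHom _

theorem opOfFinsupp_apply (f : LatHomRay E →₀ F) (x : E) :
    (opOfFinsupp E F f).1 x = ∑ i ∈ f.support, i.hom x • f i := by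
  simp [opOfFinsupp, LinearMap.codRestrict, Finsupp.lsum_apply, Finsupp.sum, LinearMap.sum_apply]

theorem exists_opOfFinsupp_apply_eq (f : LatHomRay E →₀ F) (i : LatHomRay E) :
    ∃ x : E, 0 ≤ x ∧ (opOfFinsupp E F f).1 x = f i := by
  obtain ⟨x, hx, hxi, hxs⟩ := i.exists_dual f.support
  refine ⟨x, hx, ?_⟩
  rw [opOfFinsupp_apply, Finset.sum_eq_single i]
  · rw [hxi, one_smul]
  · intro j hj hji
    rw [hxs j hj hji, zero_smul]
  · intro hi
    rw [Finsupp.notMem_support_iff.1 hi, smul_zero]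

theorem opOfFinsupp_nonneg_iff (f : LatHomRay E →₀ F) :
    (∀ x : E, 0 ≤ x → 0 ≤ (opOfFinsupp E F f).1 x) ↔ 0 ≤ f := by
  refine ⟨fun h i => ?_, fun h x hx => ?_⟩
  · obtain ⟨x, hx, hxi⟩ := exists_opOfFinsupp_apply_eq f i
    rw [← hxi]; exact h x hx
  · rw [opOfFinsupp_apply]
    exact Finset.sum_nonneg fun i _ => smul_nonneg (i.isLatHom.nonneg hx) (h i)

theorem opOfFinsupp_le_iff (f g : LatHomRay E →₀ F) :
    opOfFinsupp E F f ≤ opOfFinsupp E F g ↔ f ≤ g := by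
  rw [← sub_nonneg (a := g), ← opOfFinsupp_nonneg_iff, map_sub]
  refine forall₂_congr fun x _ => ?_
  rw [AddSubgroupClass.coe_sub, LinearMap.sub_apply, sub_nonneg]

/-- Dual vectors recover the coefficients. For surjectivity, each nonzero coordinate homomorphism in
the finite representation is rescaled to the representative of its ray. -/
theorem opOfFinsupp_bijective (hE_ded : DedekindSigmaComplete E)
    (hE_lat : LaterallySigmaComplete E) : Function.Bijective (opOfFinsupp E F) := by
  refine ⟨?_, fun T => ?_⟩
  · rw [injective_iff_map_eq_zero]
    intro f hf
    ext i
    obtain ⟨x, -, hxi⟩ := exists_opOfFinsupp_apply_eq f i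
    rw [← hxi, hf]; rfl
  · obtain ⟨s, φ, hφ, hrepr⟩ := IsOrderBounded.exists_finite_repr hE_ded hE_lat T.2
    have h1 : ∀ a, ∃ f : LatHomRay E →₀ F, a ∈ s →
        (opOfFinsupp E F f).1 = (φ a).smulRight (T.1 a) := by
      intro a
      by_cases h0 : φ a = 0
      · exact ⟨0, fun _ => by rw [map_zero, h0]; ext; simp⟩
      by_cases ha : a ∈ s
      · obtain ⟨i, c, hc⟩ := LatHomRay.exists_eq_smul (hφ a ha) h0
        refine ⟨Finsupp.single i (c • T.1 a), fun _ => ?_⟩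
        ext x
        simp [opOfFinsupp, LinearMap.codRestrict, hc, smul_smul]
      · exact ⟨0, fun h => absurd h ha⟩
    choose f hf using h1
    refine ⟨∑ a ∈ s, f a, Subtype.ext ?_⟩
    rw [map_sum, AddSubmonoidClass.coe_finsetSum, hrepr]
    exact Finset.sum_congr rfl hf

theorem luonLb_eq_top (hE_ded : DedekindSigmaComplete E)
    (hE_lat : LaterallySigmaComplete E) : LuonLb E F = ⊤ :=
  eq_top_iff.2 fun T _ => IsOrderBounded.isSigmaUonContinuous hE_ded hE_lat T.2

theorem exists_linearEquiv_finsupp (hE_ded : DedekindSigmaComplete E)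
    (hE_lat : LaterallySigmaComplete E) :
    ∃ e : Lb E F ≃ₗ[ℝ] (LatHomRay E →₀ F), ∀ S T, S ≤ T ↔ e S ≤ e T := by
  let e := LinearEquiv.ofBijective (opOfFinsupp E F) (opOfFinsupp_bijective hE_ded hE_lat)
  refine ⟨e.symm, fun S T => ?_⟩
  rw [← opOfFinsupp_le_iff]
  change _ ↔ e (e.symm S) ≤ e (e.symm T)
  rw [e.apply_symm_apply, e.apply_symm_apply]

end NormedLattice

/-! ### Order continuous functionals and maps preserving decreasing limits. -/

section NormalMaps

variable {V : Type u} [AddCommGroup V] [Preorder V] [Module ℝ V]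
  {W : Type v} [AddCommGroup W] [Preorder W] [Module ℝ W]

/-- `Z` is downward directed with infimum `0`. -/
def DecreasesToZero (Z : Set V) : Prop :=
  Z.Nonempty ∧ DirectedOn (fun s t => t ≤ s) Z ∧ IsGLB Z 0

/-- Pairs `(z, y)` with `z ∈ Z` and `-z ≤ y ≤ z`, the index set of a net `y → 0`. -/
def DominatedPair (Z : Set V) : Type u := {q : V × V // q.1 ∈ Z ∧ -q.1 ≤ q.2 ∧ q.2 ≤ q.1}

instance DominatedPair.instPreorder (Z : Set V) : Preorder (DominatedPair Z) where
  le p q := q.1.1 ≤ p.1.1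
  le_refl _ := le_rfl
  le_trans _ _ _ h h' := le_trans h' h

/-- A universe-free form of order continuity. -/
theorem isOrderContinuousFunctional_iff [IsOrderedAddMonoid V] (f : V →ₗ[ℝ] ℝ) :
    IsOrderContinuousFunctional f ↔ ∀ Z : Set V, DecreasesToZero Z → ∀ ε > 0, ∃ z ∈ Z,
      ∀ y, -z ≤ y → y ≤ z → |f y| ≤ ε := by
  constructor
  · intro hf Z hZ ε hε
    have hmem : ∀ z ∈ Z, -z ≤ (0 : V) ∧ (0 : V) ≤ z := fun z hz =>
      ⟨neg_nonpos.2 (hZ.2.2.1 hz), hZ.2.2.1 hz⟩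
    have : IsDirectedOrder (DominatedPair Z) := ⟨fun p q => by
      obtain ⟨z, hz, h1, h2⟩ := hZ.2.1 _ p.2.1 _ q.2.1
      exact ⟨⟨(z, 0), hz, hmem z hz⟩, h1, h2⟩⟩
    have : Nonempty (DominatedPair Z) := by
      obtain ⟨z, hz⟩ := hZ.1
      exact ⟨⟨(z, 0), hz, hmem z hz⟩⟩
    -- The tail beyond any index with first entry `z` contains every `y` in `[-z, z]`, so
    -- convergence along this one net is uniform on that interval.
    have hconv : OrdTendsto (fun i : DominatedPair Z => i.1.2) 0 := by
      refine ⟨Z, hZ.1, hZ.2.1, hZ.2.2, fun z hz => ⟨⟨(z, 0), hz, hmem z hz⟩, fun i hi => ?_⟩⟩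
      have hi : i.1.1 ≤ z := hi
      rw [sub_zero]
      exact ⟨(neg_le_neg_iff.2 hi).trans i.2.2.1, i.2.2.2.trans hi⟩
    have h := hf (DominatedPair Z) _ hconv
    obtain ⟨i₀, hi₀⟩ := eventually_atTop.1 (Metric.tendsto_nhds.1 h ε hε)
    refine ⟨i₀.1.1, i₀.2.1, fun y h1 h2 => ?_⟩
    have := hi₀ ⟨(i₀.1.1, y), i₀.2.1, h1, h2⟩ (le_refl i₀.1.1)
    rw [Real.dist_eq, sub_zero] at this
    exact this.le
  · rintro hf ι _ _ _ x ⟨Z, h1, h2, h3, h4⟩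
    rw [Metric.tendsto_nhds]
    intro ε hε
    obtain ⟨z, hz, h⟩ := hf Z ⟨h1, h2, h3⟩ (ε / 2) (by positivity)
    obtain ⟨i₀, hi⟩ := h4 z hz
    refine eventually_atTop.2 ⟨i₀, fun i hii => ?_⟩
    have h5 := hi i hii
    rw [sub_zero] at h5
    rw [Real.dist_eq, sub_zero]
    exact lt_of_le_of_lt (h _ h5.1 h5.2) (by linarith)

theorem isOrderBounded_of_monotone {f : V →ₗ[ℝ] ℝ} (hf : Monotone f) : IsOrderBounded f :=
  fun a b => ⟨f a, f b, by rintro _ ⟨x, hx, rfl⟩; exact ⟨hf hx.1, hf hx.2⟩⟩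

/-- Monotone linear maps that preserve decreasing limits `0`. -/
structure IsNormalMap (r : V →ₗ[ℝ] W) : Prop where
  mono : Monotone r
  isGLB_image : ∀ Z : Set V, DecreasesToZero Z → IsGLB (r '' Z) 0

theorem IsNormalMap.image {r : V →ₗ[ℝ] W} (hr : IsNormalMap r) {Z : Set V}
    (hZ : DecreasesToZero Z) : DecreasesToZero (r '' Z) := by
  refine ⟨hZ.1.image r, ?_, hr.isGLB_image Z hZ⟩
  rintro _ ⟨a, ha, rfl⟩ _ ⟨b, hb, rfl⟩
  obtain ⟨c, hc, h1, h2⟩ := hZ.2.1 a ha b hb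
  exact ⟨_, ⟨c, hc, rfl⟩, hr.mono h1, hr.mono h2⟩

variable [IsOrderedAddMonoid V] [IsOrderedAddMonoid W]

theorem IsNormalMap.comp_mem {r : V →ₗ[ℝ] W} (hr : IsNormalMap r) {f : W →ₗ[ℝ] ℝ}
    (hf : f ∈ OrdContDual W) : f ∘ₗ r ∈ OrdContDual V := by
  refine ⟨fun a b => ?_, (isOrderContinuousFunctional_iff _).2 fun Z hZ ε hε => ?_⟩
  · obtain ⟨c, d, h⟩ := hf.1 (r a) (r b)
    refine ⟨c, d, ?_⟩
    rintro _ ⟨x, hx, rfl⟩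
    exact h ⟨r x, ⟨hr.mono hx.1, hr.mono hx.2⟩, rfl⟩
  · obtain ⟨_, ⟨z, hz, rfl⟩, h⟩ :=
      (isOrderContinuousFunctional_iff f).1 hf.2 (r '' Z) (hr.image hZ) ε hε
    refine ⟨z, hz, fun y h1 h2 => h (r y) ?_ (hr.mono h2)⟩
    rw [← map_neg]
    exact hr.mono h1

/-- The dual of a normal map. -/
def IsNormalMap.dualMap {r : V →ₗ[ℝ] W} (hr : IsNormalMap r) :
    OrdContDual W →ₗ[ℝ] OrdContDual V where
  toFun f := ⟨f.1 ∘ₗ r, hr.comp_mem f.2⟩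
  map_add' _ _ := rfl
  map_smul' _ _ := rfl

theorem IsNormalMap.dualMap_apply {r : V →ₗ[ℝ] W} (hr : IsNormalMap r) (f : OrdContDual W)
    (x : V) : (hr.dualMap f).1 x = f.1 (r x) := rfl

instance OrdContDual.instIsOrderedAddMonoid : IsOrderedAddMonoid (OrdContDual V) where
  add_le_add_left _ _ h c x hx := add_le_add_left (h x hx) (c.1 x)

end NormalMaps

/-! ### Positive majorants of order continuous functionals. -/

section RieszKantorovich

variable {F : Type v} [AddCommGroup F] [Lattice F] [IsOrderedAddMonoid F]
  [Module ℝ F] [IsOrderedModule ℝ F]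

/-- The extension is `q x⁺ - q x⁻`; `hsub` shows that any other decomposition into positive vectors
gives the same value. -/
theorem exists_linearMap_eq_of_nonneg {q : F → ℝ}
    (hadd : ∀ x y, 0 ≤ x → 0 ≤ y → q (x + y) = q x + q y)
    (hsmul : ∀ (c : ℝ) x, 0 ≤ c → 0 ≤ x → q (c • x) = c * q x) :
    ∃ g : F →ₗ[ℝ] ℝ, ∀ x, 0 ≤ x → g x = q x := by
  have hsub : ∀ x y, 0 ≤ x → 0 ≤ y → q (x - y)⁺ - q (x - y)⁻ = q x - q y := by
    intro x y hx hy
    have h1 : (x - y)⁺ + y = (x - y)⁻ + x := by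
      have := posPart_sub_negPart (x - y)
      rw [sub_eq_sub_iff_add_eq_add] at this
      rw [this, add_comm]
    have h2 := congrArg q h1
    rw [hadd _ _ (posPart_nonneg _) hy, hadd _ _ (negPart_nonneg _) hx] at h2
    linarith
  refine ⟨⟨⟨fun x => q x⁺ - q x⁻, fun x y => ?_⟩, fun c x => ?_⟩, fun x hx => ?_⟩
  · have h := hsub (x⁺ + y⁺) (x⁻ + y⁻) (add_nonneg (posPart_nonneg x) (posPart_nonneg y))
      (add_nonneg (negPart_nonneg x) (negPart_nonneg y))
    rw [add_sub_add_comm, posPart_sub_negPart, posPart_sub_negPart,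
      hadd _ _ (posPart_nonneg x) (posPart_nonneg y),
      hadd _ _ (negPart_nonneg x) (negPart_nonneg y)] at h
    rw [h]; ring
  · simp only [RingHom.id_apply, smul_eq_mul]
    rcases le_total 0 c with hc | hc
    · have h := hsub (c • x⁺) (c • x⁻) (smul_nonneg hc (posPart_nonneg x))
        (smul_nonneg hc (negPart_nonneg x))
      rw [← smul_sub, posPart_sub_negPart, hsmul c _ hc (posPart_nonneg x),
        hsmul c _ hc (negPart_nonneg x)] at h
      rw [h]; ring
    · have hc' := neg_nonneg.2 hc
      have h := hsub (-c • x⁻) (-c • x⁺) (smul_nonneg hc' (negPart_nonneg x))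
        (smul_nonneg hc' (posPart_nonneg x))
      rw [← smul_sub, ← neg_sub x⁺ x⁻, neg_smul_neg, posPart_sub_negPart,
        hsmul _ _ hc' (posPart_nonneg x), hsmul _ _ hc' (negPart_nonneg x)] at h
      rw [h]; ring
  · have h := hsub x 0 hx le_rfl
    have h0 : q 0 = 0 := by simpa using hadd 0 0 le_rfl le_rfl
    rwa [sub_zero, h0, sub_zero] at h

/-- Every element of the order continuous dual of a vector lattice has a positive upper bound. -/
theorem OrdContDual.exists_nonneg_ge (f : OrdContDual F) :
    ∃ g : OrdContDual F, 0 ≤ g ∧ f ≤ g := by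
  have hbdd : ∀ x : F, BddAbove (f.1 '' Set.Icc 0 x) := fun x => by
    obtain ⟨c, d, h⟩ := f.2.1 0 x
    exact ⟨d, fun r hr => (h hr).2⟩
  -- The Riesz–Kantorovich formula for `f⁺`. A bound for `|f|` on `[-z, z]` also bounds `q z`, which
  -- transfers order continuity.
  let q : F → ℝ := fun x => sSup (f.1 '' Set.Icc 0 x)
  have hle : ∀ x y : F, 0 ≤ y → y ≤ x → f.1 y ≤ q x := fun x y h0 h =>
    le_csSup (hbdd x) ⟨y, ⟨h0, h⟩, rfl⟩
  have hsup : ∀ (x : F) (M : ℝ), 0 ≤ x → (∀ y, 0 ≤ y → y ≤ x → f.1 y ≤ M) → q x ≤ M := by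
    intro x M hx h
    refine csSup_le (Set.Nonempty.image _ ⟨0, le_rfl, hx⟩) ?_
    rintro _ ⟨y, hy, rfl⟩
    exact h y hy.1 hy.2
  have hadd : ∀ x y, 0 ≤ x → 0 ≤ y → q (x + y) = q x + q y := by
    intro x y hx hy
    refine le_antisymm (hsup _ _ (add_nonneg hx hy) fun z h0 h => ?_) ?_
    · have h1 := hle x (z ⊓ x) (le_inf h0 hx) inf_le_right
      have h2 : f.1 (z - z ⊓ x) ≤ q y := by
        refine hle y _ (sub_nonneg.2 inf_le_left) ?_
        rw [sub_le_comm]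
        refine le_inf (sub_le_self _ hy) ?_
        rwa [sub_le_iff_le_add]
      rw [map_sub] at h2
      linarith
    · rw [← le_sub_iff_add_le]
      refine hsup x _ hx fun s hs0 hs => ?_
      rw [le_sub_comm]
      refine hsup y _ hy fun t ht0 ht => ?_
      have := hle (x + y) (s + t) (add_nonneg hs0 ht0) (add_le_add hs ht)
      rw [map_add] at this
      linarith
  have hsmul' : ∀ (c : ℝ) x, 0 < c → 0 ≤ x → q (c • x) ≤ c * q x := by
    intro c x hc hx
    refine hsup _ _ (smul_nonneg hc.le hx) fun z h0 h => ?_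
    have h1 : f.1 (c⁻¹ • z) ≤ q x := by
      refine hle x _ (smul_nonneg (inv_nonneg.2 hc.le) h0) ?_
      rw [← inv_smul_smul₀ hc.ne' x]
      exact smul_le_smul_of_nonneg_left h (inv_nonneg.2 hc.le)
    rwa [map_smul, smul_eq_mul, inv_mul_le_iff₀ hc] at h1
  have hsmul : ∀ (c : ℝ) x, 0 ≤ c → 0 ≤ x → q (c • x) = c * q x := by
    intro c x hc hx
    rcases hc.eq_or_lt with rfl | hc
    · have : q 0 = 0 := by simpa using hadd 0 0 le_rfl le_rfl
      rw [zero_smul, zero_mul, this]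
    · refine le_antisymm (hsmul' c x hc hx) ?_
      have h := hsmul' c⁻¹ (c • x) (inv_pos.2 hc) (smul_nonneg hc.le hx)
      rwa [inv_smul_smul₀ hc.ne', le_inv_mul_iff₀ hc] at h
  obtain ⟨g, hg⟩ := exists_linearMap_eq_of_nonneg hadd hsmul
  have hg0 : ∀ x, 0 ≤ x → 0 ≤ g x := fun x hx => by
    rw [hg x hx]; simpa using hle x 0 le_rfl hx
  have hmono : Monotone g := fun x y hxy => by
    have := hg0 _ (sub_nonneg.2 hxy)
    rwa [map_sub, sub_nonneg] at this
  refine ⟨⟨g, isOrderBounded_of_monotone hmono,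
    (isOrderContinuousFunctional_iff g).2 fun Z hZ ε hε => ?_⟩, hg0, fun x hx => ?_⟩
  · obtain ⟨z, hz, h⟩ := (isOrderContinuousFunctional_iff f.1).1 f.2.2 Z hZ ε hε
    have hz0 : 0 ≤ z := hZ.2.2.1 hz
    refine ⟨z, hz, fun y h1 h2 => ?_⟩
    have h3 : g z ≤ ε := by
      rw [hg z hz0]
      refine hsup z ε hz0 fun t ht0 ht => ?_
      exact (le_abs_self _).trans (h t ((neg_nonpos.2 hz0).trans ht0) ht)
    have h4 := hmono h1
    have h5 := hmono h2
    rw [map_neg] at h4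
    rw [abs_le]
    constructor <;> linarith
  · change f.1 x ≤ g x
    rw [hg x hx]
    exact hle x x hx le_rfl

end RieszKantorovich

/-! ### Perfectness of direct sums. -/

section DirectSum

variable {ι : Type w} {F : Type v} [AddCommGroup F] [Lattice F] [IsOrderedAddMonoid F]
  [Module ℝ F] [IsOrderedModule ℝ F]
  {G : Type u} [AddCommGroup G] [Preorder G] [IsOrderedAddMonoid G] [Module ℝ G]
  (e : G ≃ₗ[ℝ] (ι →₀ F))

/-- The `i`-th coordinate map of a direct sum. -/
noncomputable def sumProj (i : ι) : G →ₗ[ℝ] F := Finsupp.lapply i ∘ₗ e.toLinearMap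

/-- The inclusion of the `i`-th summand of a direct sum. -/
noncomputable def sumIncl (i : ι) : F →ₗ[ℝ] G := e.symm.toLinearMap ∘ₗ Finsupp.lsingle i

theorem sumProj_apply (i : ι) (x : G) : sumProj e i x = e x i := rfl

theorem apply_sumIncl (i : ι) (y : F) : e (sumIncl e i y) = Finsupp.single i y :=
  e.apply_symm_apply _

theorem sumProj_sumIncl_same (i : ι) (y : F) : sumProj e i (sumIncl e i y) = y := by
  rw [sumProj_apply, apply_sumIncl, Finsupp.single_eq_same]

theorem sumProj_sumIncl_of_ne {i j : ι} (h : j ≠ i) (y : F) :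
    sumProj e j (sumIncl e i y) = 0 := by
  rw [sumProj_apply, apply_sumIncl, Finsupp.single_eq_of_ne h]

theorem sum_sumIncl_sumProj {s : Finset ι} {x : G} (hs : (e x).support ⊆ s) :
    ∑ i ∈ s, sumIncl e i (sumProj e i x) = x := by
  apply e.injective
  simp only [map_sum, apply_sumIncl, sumProj_apply]
  rw [← Finset.sum_subset hs fun i _ hi => by
    rw [Finsupp.notMem_support_iff.1 hi, Finsupp.single_zero]]
  exact Finsupp.sum_single (e x)

variable {e} (he : ∀ x y, x ≤ y ↔ e x ≤ e y)
include he

theorem nonneg_iff_sumProj {x : G} : 0 ≤ x ↔ ∀ i, 0 ≤ sumProj e i x := by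
  rw [he, map_zero]; rfl

theorem sumProj_mono (i : ι) : Monotone (sumProj e i) := fun _ _ h => (he _ _).1 h i

/-- A partial Galois connection, through which lower bounds move between a summand and the sum. -/
theorem sumIncl_le_iff {i : ι} {y : F} {x : G} (hx : ∀ j, j ≠ i → 0 ≤ sumProj e j x) :
    sumIncl e i y ≤ x ↔ y ≤ sumProj e i x := by
  rw [he, apply_sumIncl]
  refine ⟨fun h => by simpa [sumProj_apply] using h i, fun h j => ?_⟩
  rcases eq_or_ne j i with rfl | hj
  · simpa [sumProj_apply] using h
  · rw [Finsupp.single_eq_of_ne hj]; exact hx j hj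

theorem sumIncl_mono (i : ι) : Monotone (sumIncl e i) := fun y y' h => by
  rw [sumIncl_le_iff he fun j hj => (sumProj_sumIncl_of_ne e hj y').ge, sumProj_sumIncl_same]
  exact h

theorem isNormalMap_sumProj (i : ι) : IsNormalMap (sumProj e i) where
  mono := sumProj_mono he i
  isGLB_image Z hZ := by
    refine ⟨?_, fun l hl => ?_⟩
    · rintro _ ⟨z, hz, rfl⟩
      exact (nonneg_iff_sumProj he).1 (hZ.2.2.1 hz) i
    · have h1 : sumIncl e i l ≤ 0 := hZ.2.2.2 fun z hz =>
        (sumIncl_le_iff he fun j _ => (nonneg_iff_sumProj he).1 (hZ.2.2.1 hz) j).2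
          (hl ⟨z, hz, rfl⟩)
      rwa [sumIncl_le_iff he fun j _ => by rw [map_zero], map_zero] at h1

theorem isNormalMap_sumIncl (i : ι) : IsNormalMap (sumIncl e i) where
  mono := sumIncl_mono he i
  isGLB_image Z hZ := by
    refine ⟨?_, fun g hg => (he _ _).2 fun j => ?_⟩
    · rintro _ ⟨z, hz, rfl⟩
      have := sumIncl_mono he i (hZ.2.2.1 hz)
      rwa [map_zero] at this
    · rw [map_zero]
      rcases eq_or_ne j i with rfl | hj
      · refine hZ.2.2.2 fun z hz => ?_
        have := sumProj_mono he j (hg ⟨z, hz, rfl⟩)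
        rwa [sumProj_sumIncl_same] at this
      · obtain ⟨z, hz⟩ := hZ.1
        have := sumProj_mono he j (hg ⟨z, hz, rfl⟩)
        rwa [sumProj_sumIncl_of_ne e hj] at this

omit he

variable (e) in
/-- The functional on a direct sum with given restrictions to the summands. -/
noncomputable def glueFunctional (k : ι → F →ₗ[ℝ] ℝ) : G →ₗ[ℝ] ℝ :=
  Finsupp.lsum ℝ k ∘ₗ e.toLinearMap

theorem glueFunctional_apply (k : ι → F →ₗ[ℝ] ℝ) {s : Finset ι} {x : G}
    (hs : (e x).support ⊆ s) : glueFunctional e k x = ∑ i ∈ s, k i (sumProj e i x) := by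
  simp only [glueFunctional, LinearMap.comp_apply, LinearEquiv.coe_coe, Finsupp.lsum_apply]
  exact Finsupp.sum_of_support_subset _ hs _ fun i _ => map_zero _

theorem glueFunctional_sumIncl (k : ι → F →ₗ[ℝ] ℝ) (i : ι) (y : F) :
    glueFunctional e k (sumIncl e i y) = k i y := by
  simp [glueFunctional, apply_sumIncl]

include he

theorem support_subset_of_mem_Icc [DecidableEq ι] {a b x : G} (ha : a ≤ x) (hb : x ≤ b) :
    (e x).support ⊆ (e a).support ∪ (e b).support := by
  intro i hi
  by_contra hab
  rw [Finset.mem_union, not_or, Finsupp.notMem_support_iff, Finsupp.notMem_support_iff] at hab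
  have h1 := (he _ _).1 ha i
  have h2 := (he _ _).1 hb i
  rw [hab.1] at h1
  rw [hab.2] at h2
  exact Finsupp.mem_support_iff.1 hi (le_antisymm h2 h1)

/-- No finiteness of the family is needed: the vectors of an order interval have supports in a
common finite set, so there the glued functional is a finite sum. -/
theorem glueFunctional_mem (k : ι → OrdContDual F) :
    glueFunctional e (fun i => (k i).1) ∈ OrdContDual G := by
  classical
  have hfin : ∀ s : Finset ι, ∑ i ∈ s, (k i).1 ∘ₗ sumProj e i ∈ OrdContDual G := fun s =>
    Submodule.sum_mem _ fun i _ => (isNormalMap_sumProj he i).comp_mem (k i).2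
  have heq : ∀ (s : Finset ι) (x : G), (e x).support ⊆ s →
      glueFunctional e (fun i => (k i).1) x = (∑ i ∈ s, (k i).1 ∘ₗ sumProj e i) x := by
    intro s x hs
    rw [glueFunctional_apply _ hs, LinearMap.sum_apply]
    rfl
  refine ⟨fun a b => ?_, (isOrderContinuousFunctional_iff _).2 fun Z hZ ε hε => ?_⟩
  · obtain ⟨c, d, h⟩ := (hfin ((e a).support ∪ (e b).support)).1 a b
    refine ⟨c, d, ?_⟩
    rintro _ ⟨x, hx, rfl⟩
    rw [heq _ x (support_subset_of_mem_Icc he hx.1 hx.2)]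
    exact h ⟨x, hx, rfl⟩
  · obtain ⟨z₀, hz₀⟩ := hZ.1
    obtain ⟨z₁, hz₁, h⟩ := (isOrderContinuousFunctional_iff _).1 (hfin (e z₀).support).2 Z hZ ε hε
    obtain ⟨z, hz, hzz₀, hzz₁⟩ := hZ.2.1 z₀ hz₀ z₁ hz₁
    refine ⟨z, hz, fun y h1 h2 => ?_⟩
    rw [heq (e z₀).support y]
    · exact h y ((neg_le_neg_iff.2 hzz₁).trans h1) (h2.trans hzz₁)
    · have := support_subset_of_mem_Icc he ((neg_le_neg_iff.2 hzz₀).trans h1) (h2.trans hzz₀)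
      rwa [map_neg, Finsupp.support_neg, Finset.union_idempotent] at this

theorem sumIncl_sumProj_le {x : G} (hx : 0 ≤ x) (i : ι) : sumIncl e i (sumProj e i x) ≤ x :=
  (sumIncl_le_iff he fun j _ => (nonneg_iff_sumProj he).1 hx j).2 le_rfl

/-- Restriction of functionals to a summand is a normal map. -/
theorem isNormalMap_dualMap_sumIncl (i : ι) :
    IsNormalMap (V := OrdContDual G) (W := OrdContDual F)
      (isNormalMap_sumIncl he i).dualMap where
  mono f g h y hy := h _ (by have := sumIncl_mono he i hy; rwa [map_zero] at this)
  isGLB_image Z hZ := by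
    have hincl : ∀ y : F, 0 ≤ y → 0 ≤ sumIncl e i y := fun y hy => by
      have := sumIncl_mono he i hy; rwa [map_zero] at this
    refine ⟨?_, fun l hl => ?_⟩
    · rintro _ ⟨z, hz, rfl⟩ y hy
      exact hZ.2.2.1 hz _ (hincl y hy)
    -- Extended by zero, `l` is a lower bound of `Z` itself, because the members of `Z` are positive
    -- and dominate their restrictions to the summand.
    · have h1 : (isNormalMap_sumProj he i).dualMap l ≤ 0 := hZ.2.2.2 fun z hz x hx => by
        have h2 := hl ⟨z, hz, rfl⟩ _ ((nonneg_iff_sumProj he).1 hx i)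
        have h3 : 0 ≤ z.1 _ := hZ.2.2.1 hz _ (sub_nonneg.2 (sumIncl_sumProj_le he hx i))
        rw [map_sub] at h3
        exact h2.trans (sub_nonneg.1 h3)
      intro y hy
      have h2 := h1 _ (hincl y hy)
      rwa [IsNormalMap.dualMap_apply, sumProj_sumIncl_same] at h2

/-- The extension of functionals from a summand by zero is a normal map. -/
theorem isNormalMap_dualMap_sumProj (i : ι) :
    IsNormalMap (V := OrdContDual F) (W := OrdContDual G)
      (isNormalMap_sumProj he i).dualMap where
  mono f g h x hx := h _ ((nonneg_iff_sumProj he).1 hx i)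
  isGLB_image Z hZ := by
    refine ⟨?_, fun g hg => ?_⟩
    · rintro _ ⟨z, hz, rfl⟩ x hx
      exact hZ.2.2.1 hz _ ((nonneg_iff_sumProj he).1 hx i)
    · have hincl : ∀ (j : ι) (y : F), 0 ≤ y → 0 ≤ sumIncl e j y := fun j y hy => by
        have := sumIncl_mono he j hy; rwa [map_zero] at this
      have h1 : (isNormalMap_sumIncl he i).dualMap g ≤ 0 := hZ.2.2.2 fun z hz y hy => by
        have h2 := hg ⟨z, hz, rfl⟩ _ (hincl i y hy)
        rwa [IsNormalMap.dualMap_apply, sumProj_sumIncl_same] at h2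
      intro x hx
      rw [← sum_sumIncl_sumProj e (x := x) subset_rfl, map_sum]
      refine Finset.sum_nonpos fun j _ => ?_
      have hxj := (nonneg_iff_sumProj he).1 hx j
      rcases eq_or_ne i j with rfl | hj
      · exact h1 _ hxj
      · obtain ⟨z, hz⟩ := hZ.1
        have h2 := hg ⟨z, hz, rfl⟩ _ (hincl j _ hxj)
        rwa [IsNormalMap.dualMap_apply, sumProj_sumIncl_of_ne e hj, map_zero] at h2

/-- A direct sum of copies of a perfect vector lattice is perfect. -/
theorem IsPerfect.of_linearEquiv_finsupp (hF : IsPerfect F) : IsPerfect G := by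
  classical
  have hmaps := hF.bijOn.mapsTo
  have hinj := hF.bijOn.injOn
  refine ⟨IsVectorLattice.of_linearEquiv e he, ?_, ?_, ?_⟩
  · intro x _
    have h1 : evalOrdContDual G x = ∑ i ∈ (e x).support,
        evalOrdContDual F (sumProj e i x) ∘ₗ (isNormalMap_sumIncl he i).dualMap := by
      ext f
      conv_lhs => rw [← sum_sumIncl_sumProj e (x := x) subset_rfl, map_sum]
      rw [LinearMap.sum_apply, LinearMap.sum_apply]
      rfl
    rw [h1]
    exact Submodule.sum_mem _ fun i _ =>
      (isNormalMap_dualMap_sumIncl he i).comp_mem (hmaps (Set.mem_univ _))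
  · intro x _ x' _ hxx
    refine e.injective (Finsupp.ext fun i => hinj (Set.mem_univ _) (Set.mem_univ _) ?_)
    ext f
    exact LinearMap.congr_fun hxx ((isNormalMap_sumProj he i).dualMap f)
  · intro Φ hΦ
    let J := fun i => (isNormalMap_sumProj he i).dualMap
    let R := fun i => (isNormalMap_sumIncl he i).dualMap
    have hex : ∀ i, ∃ y : F, evalOrdContDual F y = Φ ∘ₗ J i := fun i => by
      obtain ⟨y, -, hy⟩ := hF.bijOn.surjOn ((isNormalMap_dualMap_sumProj he i).comp_mem hΦ)
      exact ⟨y, hy⟩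
    choose y hy using hex
    have hy' : ∀ i (k : OrdContDual F), Φ (J i k) = k.1 (y i) := fun i k =>
      (LinearMap.congr_fun (hy i) k).symm
    have hincl : ∀ (j : ι) (y : F), 0 ≤ y → 0 ≤ sumIncl e j y := fun j y hy => by
      have := sumIncl_mono he j hy; rwa [map_zero] at this
    -- The dual separates points since `F` is perfect, and each functional is a difference `g - (g -
    -- k)` of positive ones.
    have hpos : ∀ i, ∃ k : OrdContDual F, 0 ≤ k ∧ (y i ≠ 0 → k.1 (y i) ≠ 0) := by
      intro i
      by_contra! hcon
      refine (hcon 0 le_rfl).1 (hinj (Set.mem_univ _) (Set.mem_univ _) ?_)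
      ext k
      obtain ⟨g, hg0, hkg⟩ := OrdContDual.exists_nonneg_ge k
      have h1 := (hcon g hg0).2
      have h2 := (hcon (g - k) (sub_nonneg.2 hkg)).2
      have h3 : g.1 (y i) - k.1 (y i) = 0 := h2
      rw [map_zero]
      change k.1 (y i) = 0
      linarith
    have hfin : {i | y i ≠ 0}.Finite := by
      by_contra hinf
      let ψ := Set.Infinite.natEmbedding _ hinf
      let n : ι → ℕ := Function.extend (fun m => (ψ m).1) id 0
      have hn : ∀ m, n (ψ m).1 = m := fun m =>
        (Subtype.val_injective.comp ψ.injective).extend_apply id 0 m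
      choose k hk0 hk using hpos
      -- Gliding hump: with these weights `Φ` takes values of modulus `m`, for every `m`, on the
      -- single order interval `[0, d]`. Where `y i = 0` the weight is `0`.
      let c : ι → ℝ := fun i => n i / |(k i).1 (y i)|
      have hc : ∀ i, 0 ≤ c i := fun i => by positivity
      let d : OrdContDual G := ⟨_, glueFunctional_mem he fun i => c i • k i⟩
      obtain ⟨a, b, hab⟩ := hΦ.1 0 d
      obtain ⟨m, hm⟩ := exists_nat_gt (|a| + |b|)
      set i := (ψ m).1
      have hck : ∀ j (z : F), 0 ≤ z → 0 ≤ (c j • k j).1 z := fun j z hz =>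
        mul_nonneg (hc j) (hk0 j z hz)
      have hd0 : 0 ≤ d := fun x hx => by
        change 0 ≤ glueFunctional e _ x
        rw [glueFunctional_apply _ subset_rfl]
        exact Finset.sum_nonneg fun j _ => hck j _ ((nonneg_iff_sumProj he).1 hx j)
      have hmem : J i (c i • k i) ∈ Set.Icc 0 d := by
        refine ⟨fun x hx => hck i _ ((nonneg_iff_sumProj he).1 hx i), fun x hx => ?_⟩
        have h1 : 0 ≤ d.1 _ := hd0 _ (sub_nonneg.2 (sumIncl_sumProj_le he hx i))
        rw [map_sub] at h1
        refine le_trans (le_of_eq ?_) (sub_nonneg.1 h1)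
        exact (glueFunctional_sumIncl (e := e) (fun i => (c i • k i).1) i _).symm
      have h1 := hab ⟨_, hmem, rfl⟩
      have h2 : |Φ (J i (c i • k i))| = m := by
        rw [hy']
        change |c i * (k i).1 (y i)| = m
        rw [abs_mul, abs_of_nonneg (hc i),
          div_mul_cancel₀ _ (abs_pos.2 (hk i (ψ m).2)).ne', hn]
      have h3 : |Φ (J i (c i • k i))| ≤ |a| + |b| := by
        have := norm_le_of_mem_Icc h1
        rwa [Real.norm_eq_abs, Real.norm_eq_abs,
          abs_of_nonneg (add_nonneg (abs_nonneg a) (abs_nonneg b))] at this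
      linarith
    set S := hfin.toFinset
    have hS : ∀ i, i ∉ S → y i = 0 := fun i hi => by
      by_contra h; exact hi (hfin.mem_toFinset.2 h)
    set x : G := ∑ i ∈ S, sumIncl e i (y i)
    refine ⟨x, Set.mem_univ _, ?_⟩
    have hx : ∀ (d : OrdContDual G) (T : Finset ι), S ⊆ T →
        Φ (∑ i ∈ T, J i (R i d)) = d.1 x := by
      intro d T hST
      simp only [x, map_sum, hy']
      symm
      exact Finset.sum_subset hST fun i _ hi => by rw [hS i hi]; simp
    have hsum : ∀ (d : OrdContDual G) (T : Finset ι) (x : G),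
        (∑ i ∈ T, J i (R i d)).1 x = ∑ i ∈ T, d.1 (sumIncl e i (sumProj e i x)) := by
      intro d T x
      rw [AddSubmonoidClass.coe_finsetSum, LinearMap.sum_apply]
      rfl
    have hnonneg : ∀ d : OrdContDual G, 0 ≤ d → Φ d = d.1 x := by
      intro d hd
      have hterm : ∀ i (x : G), 0 ≤ x → 0 ≤ d.1 (sumIncl e i (sumProj e i x)) := fun i x hx =>
        hd _ (hincl i _ ((nonneg_iff_sumProj he).1 hx i))
      have hmono : ∀ T T' : Finset ι, T ⊆ T' →
          d - ∑ i ∈ T', J i (R i d) ≤ d - ∑ i ∈ T, J i (R i d) := by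
        intro T T' hTT
        refine (sub_le_sub_iff_left d).2 fun x hx => ?_
        rw [hsum, hsum]
        exact Finset.sum_le_sum_of_subset_of_nonneg hTT fun i _ _ => hterm i x hx
      -- The remainders decrease to `0` because, at a given `x ≥ 0`, they vanish as soon as `T`
      -- contains the support of `x`. Requiring `S ⊆ T` makes `Φ` of each partial sum equal to `d.1
      -- x`.
      have hZ : DecreasesToZero
          ((fun T : Finset ι => d - ∑ i ∈ T, J i (R i d)) '' {T | S ⊆ T}) := by
        refine ⟨⟨_, S, Finset.Subset.refl S, rfl⟩, ?_, ?_, ?_⟩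
        · rintro _ ⟨T, hT, rfl⟩ _ ⟨T', hT', rfl⟩
          exact ⟨_, ⟨T ∪ T', hT.trans Finset.subset_union_left, rfl⟩,
            hmono _ _ Finset.subset_union_left, hmono _ _ Finset.subset_union_right⟩
        · rintro _ ⟨T, hT, rfl⟩
          rw [sub_nonneg]
          intro x hx
          rw [hsum]
          calc ∑ i ∈ T, d.1 (sumIncl e i (sumProj e i x))
              ≤ ∑ i ∈ T ∪ (e x).support, d.1 (sumIncl e i (sumProj e i x)) :=
                Finset.sum_le_sum_of_subset_of_nonneg Finset.subset_union_left
                  fun i _ _ => hterm i x hx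
            _ = d.1 x := by
                rw [← map_sum, sum_sumIncl_sumProj e Finset.subset_union_right]
        · intro l hl x hx
          refine (hl ⟨S ∪ (e x).support, Finset.subset_union_left, rfl⟩ x hx).trans ?_
          change d.1 x - (∑ i ∈ S ∪ (e x).support, J i (R i d)).1 x ≤ 0
          rw [hsum, ← map_sum, sum_sumIncl_sumProj e Finset.subset_union_right, sub_self]
      rw [← sub_eq_zero, ← abs_nonpos_iff]
      refine le_of_forall_pos_le_add fun ε hε => ?_
      obtain ⟨_, ⟨T, hT, rfl⟩, h⟩ := (isOrderContinuousFunctional_iff Φ).1 hΦ.2 _ hZ ε hε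
      have h0 := hZ.2.2.1 ⟨T, hT, rfl⟩
      have := h _ ((neg_nonpos.2 h0).trans h0) le_rfl
      have h2 : Φ (d - ∑ i ∈ T, J i (R i d)) = Φ d - d.1 x := by
        rw [← hx d T hT]; exact map_sub Φ _ _
      rw [zero_add, ← h2]
      exact this
    ext d
    -- To reduce a general `d` to the positive case, a positive majorant `d'` is glued from
    -- majorants on the summands; then `d` is the difference of `d'` and `d' - d`.
    have hub : ∀ i, ∃ k : OrdContDual F, 0 ≤ k ∧ R i d ≤ k := fun i =>
      OrdContDual.exists_nonneg_ge (R i d)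
    choose k hk0 hk using hub
    let d' : OrdContDual G := ⟨_, glueFunctional_mem he k⟩
    have hd'0 : 0 ≤ d' := fun x hx => by
      change 0 ≤ glueFunctional e _ x
      rw [glueFunctional_apply _ subset_rfl]
      exact Finset.sum_nonneg fun j _ => hk0 j _ ((nonneg_iff_sumProj he).1 hx j)
    have hdd' : d ≤ d' := fun x hx => by
      change _ ≤ glueFunctional e _ x
      rw [glueFunctional_apply _ subset_rfl]
      conv_lhs => rw [← sum_sumIncl_sumProj e (x := x) subset_rfl, map_sum]
      exact Finset.sum_le_sum fun j _ => hk j _ ((nonneg_iff_sumProj he).1 hx j)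
    have h1 := hnonneg d' hd'0
    have h2 : Φ d' - Φ d = d'.1 x - d.1 x :=
      (map_sub Φ d' d).symm.trans (hnonneg (d' - d) (sub_nonneg.2 hdd'))
    change d.1 x = Φ d
    linarith

end DirectSum

theorem isOrderedAddMonoid_of_linearEquiv {V : Type u} [AddCommGroup V] [Preorder V] [Module ℝ V]
    {W : Type v} [AddCommGroup W] [Preorder W] [IsOrderedAddMonoid W] [Module ℝ W]
    (e : V ≃ₗ[ℝ] W) (he : ∀ x y, x ≤ y ↔ e x ≤ e y) : IsOrderedAddMonoid V where
  add_le_add_left x y h z := by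
    rw [he, map_add, map_add]
    exact add_le_add_left ((he _ _).1 h) _

end RieszUON

theorem mainTheorem7
    {E : Type u} [AddCommGroup E] [Lattice E] [IsOrderedAddMonoid E]
    [Module ℝ E] [IsOrderedModule ℝ E]
    {F : Type v} [NormedAddCommGroup F] [Lattice F] [IsOrderedAddMonoid F] [HasSolidNorm F]
    [NormedSpace ℝ F] [IsOrderedModule ℝ F]
    (hE_ded : RieszUON.DedekindSigmaComplete E) (hE_lat : RieszUON.LaterallySigmaComplete E)
    (hF_atomic : RieszUON.IsAtomicLattice F) (hF_oc : RieszUON.HasOrderContinuousNorm F) :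
    (∀ T : E →ₗ[ℝ] F, RieszUON.IsOrderBounded T →
      (RieszUON.IsSigmaOrderContinuous T ↔ RieszUON.IsSigmaUonContinuous T)) ∧
    RieszUON.IsVectorLattice (RieszUON.Lb E F) ∧
    RieszUON.IsBand (RieszUON.LuonLb E F) ∧
    (RieszUON.IsPerfect F → RieszUON.IsPerfect (RieszUON.LuonLb E F)) := by
  obtain ⟨e, he⟩ := RieszUON.exists_linearEquiv_finsupp (F := F) hE_ded hE_lat
  have htop := RieszUON.luonLb_eq_top (F := F) hE_ded hE_lat
  refine ⟨fun T hT => ⟨fun _ => hT.isSigmaUonContinuous hE_ded hE_lat,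
    fun _ => hT.isSigmaOrderContinuous hE_ded hE_lat⟩,
    RieszUON.IsVectorLattice.of_linearEquiv e he, htop ▸ RieszUON.isBand_top, fun hF => ?_⟩
  let e' := (LinearEquiv.ofTop _ htop).trans e
  have he' : ∀ S T, S ≤ T ↔ e' S ≤ e' T := fun S T => he S.1 T.1
  have := RieszUON.isOrderedAddMonoid_of_linearEquiv (V := RieszUON.LuonLb E F) e' he'
  exact RieszUON.IsPerfect.of_linearEquiv_finsupp he' hF
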